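/- Let $\tau$ be in the upper half-plane, $\Lambda=\mathbb{Z}+\mathbb{Z}\tau$, $\mathbb{T}=\mathbb{C}/\Lambda$, let $\wp$ be the Weierstrass function of $\Lambda$, and let $\gamma=[\tfrac{\tau}{2},\tfrac{\tau}{2}+1]$ be oriented from $\tfrac{\tau}{2}$ to $\tfrac{\tau}{2}+1$. Put $\mathcal{E}_{2k}=\wp^k$ and $\mathcal{E}_{2k+3}=-\tfrac12\wp'\wp^k$ for $k\ge 0$, $\mu_{i,j}=\int_\gamma \mathcal{E}_i\mathcal{E}_j\,dz$, and $D_n=\det(\mu_{i,j})$ with $i,j\in\{0,2,3,\dots,n-1\}$. If $D_n\neq 0$, let $$\pi_n(z)=\frac{1}{D_n}\det\begin{pmatrix}(\mu_{i,j})_{i\in\{0,2,\dots,n-1\}}\\ \mathcal{E}_j(z)\end{pmatrix}_{j\in\{0,2,3,\dots,n\}},\qquad h_n=\int_\gamma \pi_n(z)^2\,dz,$$ that is, $\pi_n$ is the monic elliptic orthogonal polynomial of degree $n$ for the constant weight $1$ on $\gamma$, and $h_n$ is its norm. A solution of the Riemann--Hilbert problem of index $n$ is a $2\times 2$ matrix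 function $Y_n$, analytic on $\mathbb{T}\setminus(\gamma\cup\{0\})$, whose limits $Y_{n,\pm}$ on $\gamma$ from the left ($+$) and from the right ($-$) exist and satisfy $Y_{n,+}=Y_{n,-}\begin{pmatrix}1&1\\0&1\end{pmatrix}$, and such that $Y_n(z)=(\mathbb{1}+\mathcal{O}(z))\begin{pmatrix}z^{-n}&0\\0&z^{n-2}\end{pmatrix}$ as $z\to 0$. **Proposition.** Let $n\ge 3$, suppose that $D_n\ne 0$ and $D_{n+1}\neq 0$, let $Y_n$ and $Y_{n+1}$ be solutions of the Riemann--Hilbert problems of index $n$ and $n+1$, and let $f_n=\det Y_n$ and $f_{n+1}=\det Y_{n+1}$. Then $$Y_{n+1}=R_nY_n,\qquad R_n=\frac{1}{f_n}\begin{pmatrix}-\tfrac12\wp' & -\dfrac{h_n}{2\pi i}f_{n+1}\\[2mm] \dfrac{2\pi i}{h_n}f_n & 0\end{pmatrix}$$ at every point of $\mathbb{T}\setminus(\gamma\cup\{0\})$ where $f_n\neq 0$. Moreover, for $m=n$ and $m=n+1$ there are constants $c_{2,m}$ and $\widetilde c_{2,m-1}$ such that, as $z\to 0$, $$(Y_m)_{11}(z)=z^{-m}\bigl(1+c_{2,m}z^2+\mathcal{O}(z^3)\bigr),\qquad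 (Y_m)_{22}(z)=z^{m-2}\bigl(1+\widetilde c_{2,m-1}z^2+\mathcal{O}(z^3)\bigr),$$ and $f_m=\wp+\alpha_m$ on $\mathbb{T}\setminus(\gamma\cup\{0\})$ with $\alpha_m=c_{2,m}+\widetilde c_{2,m-1}-\dfrac{h_m}{h_{m-1}}$, where the quotient $h_m/h_{m-1}$ is read as $0$ if $D_{m-1}=0$. -/

import Mathlib

open Filter Topology Asymptotics

noncomputable section

namespace EllipticOP

/-- The pair of periods `(1, τ)`, with `τ` in the upper half-plane. -/
def periods (τ : UpperHalfPlane) : PeriodPair where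
  ω₁ := 1
  ω₂ := (τ : ℂ)
  indep := by
    rw [LinearIndependent.pair_iff]
    intro s t h
    have him := congrArg Complex.im h
    have hre := congrArg Complex.re h
    have ht : t = 0 := by
      rcases (by simpa using him : t = 0 ∨ τ.im = 0) with h0 | h0
      · exact h0
      · exact absurd h0 τ.im_pos.ne'
    subst ht
    exact ⟨by simpa using hre, rfl⟩

/-- The lattice `ℤ + ℤ τ`. -/
def Λ (τ : UpperHalfPlane) : Submodule ℤ ℂ := (periods τ).lattice

/-- The Weierstrass function `℘` of the lattice `ℤ + ℤ τ`. -/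
def wp (τ : UpperHalfPlane) : ℂ → ℂ := (periods τ).weierstrassP

/-- The derivative `℘'` of the Weierstrass function. -/
def wp' (τ : UpperHalfPlane) : ℂ → ℂ := (periods τ).derivWeierstrassP

/-- The parametrisation of the contour `γ = [τ/2, τ/2 + 1]`, oriented from `τ/2` to `τ/2 + 1`,
by `t ∈ [0, 1]`. -/
def γ (τ : UpperHalfPlane) (t : ℝ) : ℂ := (τ : ℂ) / 2 + t

/-- The integral `∫_γ g(z) dz`. -/
def integralγ (τ : UpperHalfPlane) (g : ℂ → ℂ) : ℂ := ∫ t in (0 : ℝ)..1, g (γ τ t)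

/-- The basis of elliptic polynomials: `E (2k) = ℘ ^ k` and `E (2k+3) = -(1/2) ℘' ℘ ^ k`.
There is no elliptic polynomial of degree one: the value at index `1` is never used. -/
def E (τ : UpperHalfPlane) (n : ℕ) (z : ℂ) : ℂ :=
  if Even n then wp τ z ^ (n / 2) else -(1 / 2) * wp' τ z * wp τ z ^ ((n - 3) / 2)

/-- The moments `μ i j = ∫_γ E_i E_j dz` of the constant weight `1`. -/
def moment (τ : UpperHalfPlane) (i j : ℕ) : ℂ := integralγ τ fun z => E τ i z * E τ j z

/-- The set of degrees `{0, 2, 3, …, n - 1}`. -/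
abbrev Idx (n : ℕ) : Type := {i // i ∈ (Finset.range n).erase 1}

/-- The moment determinant `D_n = det (μ i j)`, with `i, j` in `{0, 2, 3, …, n - 1}`. -/
def D (τ : UpperHalfPlane) (n : ℕ) : ℂ :=
  (Matrix.of fun i j : Idx n => moment τ i j).det

/-- The monic elliptic orthogonal polynomial `π_n` (for `n ≠ 1` and `D_n ≠ 0`): `D_n⁻¹` times the
determinant over `{0, 2, 3, …, n}` whose rows `i < n` are the moments `μ i j` and whose last row
is `E_j(z)`. -/
def eop (τ : UpperHalfPlane) (n : ℕ) (z : ℂ) : ℂ :=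
  (D τ n)⁻¹ *
    (Matrix.of fun i j : Idx (n + 1) => if (i : ℕ) = n then E τ j z else moment τ i j).det

/-- The norm `h_n = ∫_γ π_n² dz`. -/
def h (τ : UpperHalfPlane) (n : ℕ) : ℂ := integralγ τ fun z => eop τ n z ^ 2

/-- The preimage in `ℂ` of the torus `ℂ / (ℤ + ℤ τ)` with the point `0` and the contour `γ`
removed. -/
def domain (τ : UpperHalfPlane) : Set ℂ :=
  {z | z ∉ Λ τ ∧ ∀ t ∈ Set.Icc (0 : ℝ) 1, z - γ τ t ∉ Λ τ}

/-- `Y` solves the Riemann-Hilbert problem of index `n` for the constant weight `1`. A function on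
the torus is a doubly periodic function on the plane; its values outside `domain τ` play no
role. -/
structure IsRHPSolution (τ : UpperHalfPlane) (n : ℕ) (Y : ℂ → Matrix (Fin 2) (Fin 2) ℂ) :
    Prop where
  /-- `Y` is a function on the torus. -/
  periodic : ∀ z ∈ domain τ, ∀ l ∈ Λ τ, Y (z + l) = Y z
  /-- `Y` is analytic off the contour and the origin. -/
  analytic : ∀ i j, AnalyticOnNhd ℂ (fun z => Y z i j) (domain τ)
  /-- On `γ`, the limits `Yp` from the left (above) and `Ym` from the right (below) exist, and
  satisfy the jump condition. -/
  jump : ∀ t ∈ Set.Icc (0 : ℝ) 1, ∃ Yp Ym : Matrix (Fin 2) (Fin 2) ℂ,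
    Tendsto Y (𝓝[{z | (γ τ t).im < z.im}] (γ τ t)) (𝓝 Yp) ∧
    Tendsto Y (𝓝[{z | z.im < (γ τ t).im}] (γ τ t)) (𝓝 Ym) ∧
    Yp = Ym * !![1, 1; 0, 1]
  /-- `Y(z) diag(z^n, z^(2-n)) = 1 + O(z)` as `z → 0`. -/
  asymp : ∀ i j, (fun z : ℂ =>
      (Y z * Matrix.diagonal ![z ^ (n : ℤ), z ^ (2 - n : ℤ)]) i j
        - (1 : Matrix (Fin 2) (Fin 2) ℂ) i j) =O[𝓝[≠] 0] fun z : ℂ => z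

/-- The matrix `R_n(z)`, with `f = f_n` and `f₁ = f_{n+1}`. -/
def R (τ : UpperHalfPlane) (n : ℕ) (f f₁ : ℂ → ℂ) (z : ℂ) : Matrix (Fin 2) (Fin 2) ℂ :=
  (1 / f z) •
    !![-(wp' τ z) / 2, -(h τ n / (2 * Real.pi * Complex.I)) * f₁ z;
      (2 * Real.pi * Complex.I / h τ n) * f z, 0]

/-- `α` is the constant `α_n = c_{2,n} + c̃_{2,n-1} - h_n / h_{n-1}`, where `Y` is the solution of
index `n` and, as `z → 0`,
`Y₁₁(z) = z^(-n) (1 + c_{2,n} z² + O(z³))` and `Y₂₂(z) = z^(n-2) (1 + c̃_{2,n-1} z² + O(z³))`.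
The norm `h_{n-1}` is defined only if `D_{n-1} ≠ 0`; the quotient `h_n / h_{n-1}` is
`h_n D_{n-1} / D_n`, which only needs `D_n ≠ 0`, so it is written in the latter form if
`D_{n-1} = 0`, where it vanishes. -/
def IsAlpha (τ : UpperHalfPlane) (n : ℕ) (Y : ℂ → Matrix (Fin 2) (Fin 2) ℂ) (α : ℂ) : Prop :=
  ∃ c c' : ℂ,
    (fun z : ℂ => z ^ (n : ℤ) * Y z 0 0 - (1 + c * z ^ 2)) =O[𝓝[≠] 0] (fun z : ℂ => z ^ 3) ∧
    (fun z : ℂ => z ^ (2 - n : ℤ) * Y z 1 1 - (1 + c' * z ^ 2)) =O[𝓝[≠] 0] (fun z : ℂ => z ^ 3) ∧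
    α = c + c' - if D τ (n - 1) = 0 then 0 else h τ n / h τ (n - 1)

end EllipticOP

end

namespace EllipticOP

/-! Two facts about the torus cut along `γ` carry everything. If `F` is sectionally analytic with at
most a simple pole at 0, its jump integrates to `2πi` times the residue (`Sectional.integral_jump`);
with neither jump nor pole, `F` is constant (`Sectional.exists_const`). Hence a function without
jump whose only pole is at 0 is an elliptic polynomial (`Sectional.exists_ellipticPoly`).

A row `(u, v)` of a solution therefore has an elliptic polynomial `u`, whose moments against `E_i`
are `2πi` times the residues of `v E_i`, where these poles are at most simple (`Row.sum_eq`). If `u`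
has degree at most `m`, `v` vanishes to order `m`, and `D_{m+1} ≠ 0`, all relevant moments are zero
and so is the row (`Row.eq_zero`). Applied to differences of rows, this gives the parity of the
entries and shows that the second row of `Y_{n+1}` is `2πi / h_n` times the first row of `Y_n`
(`RowData.snd_row_succ`).

Now `R_n = Y_{n+1} adj(Y_n) / f_n`. The proportionality of rows yields three entries of this
product. The remaining one has no jump because the jump matrix has determinant one; it is odd with a
triple pole of coefficient one, so it is `E_3` (`RowData.mul_sub_eq`). Likewise `f_n` has no jump
and a double pole; parity excludes the `z⁻¹` term, and the constant term is read off from the four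
entries (`RowData.det_eq`). -/

variable {τ : UpperHalfPlane}

/-! ### The lattice, the strip and the cut torus -/

lemma mem_Λ {z : ℂ} : z ∈ Λ τ ↔ ∃ m n : ℤ, (m : ℂ) + n * (τ : ℂ) = z := by
  rw [Λ, PeriodPair.mem_lattice]
  simp [periods]

lemma intCast_mem_Λ (m : ℤ) : (m : ℂ) ∈ Λ τ := mem_Λ.2 ⟨m, 0, by simp⟩

lemma one_mem_Λ : (1 : ℂ) ∈ Λ τ := by simpa using intCast_mem_Λ (τ := τ) 1

lemma τ_mem_Λ : (τ : ℂ) ∈ Λ τ := mem_Λ.2 ⟨0, 1, by simp⟩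

lemma countable_Λ : ((Λ τ : Submodule ℤ ℂ) : Set ℂ).Countable := by
  have : Countable ((Λ τ : Submodule ℤ ℂ) : Set ℂ) :=
    (periods τ).latticeEquivProd.toEquiv.countable_iff.2 inferInstance
  exact Set.to_countable _

lemma isClosed_Λ : IsClosed ((Λ τ : Submodule ℤ ℂ) : Set ℂ) := (periods τ).isClosed_lattice

/-- The open strip between the contours `γ - τ` and `γ`. -/
def strip (τ : UpperHalfPlane) : Set ℂ := Complex.im ⁻¹' Set.Ioo (-(τ.im / 2)) (τ.im / 2)

/-- The closed strip between the contours `γ - τ` and `γ`. -/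
def closedStrip (τ : UpperHalfPlane) : Set ℂ := Complex.im ⁻¹' Set.Icc (-(τ.im / 2)) (τ.im / 2)

lemma mem_strip {z : ℂ} : z ∈ strip τ ↔ -(τ.im / 2) < z.im ∧ z.im < τ.im / 2 := Iff.rfl

lemma mem_closedStrip {z : ℂ} :
    z ∈ closedStrip τ ↔ -(τ.im / 2) ≤ z.im ∧ z.im ≤ τ.im / 2 := Iff.rfl

lemma isOpen_strip : IsOpen (strip τ) := isOpen_Ioo.preimage Complex.continuous_im

lemma closure_strip : closure (strip τ) = closedStrip τ := by
  have := τ.im_pos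
  rw [strip, Complex.closure_preimage_im, closure_Ioo (by linarith)]
  rfl

lemma strip_subset_closedStrip : strip τ ⊆ closedStrip τ := fun _ h => ⟨h.1.le, h.2.le⟩

lemma zero_mem_strip : (0 : ℂ) ∈ strip τ := by
  have := τ.im_pos
  rw [mem_strip]
  constructor <;> simp <;> linarith

/-- A countable set has dense complement. Limits taken along the strip minus the lattice are
therefore unique at every point of the closed strip. -/
lemma closedStrip_subset_closure : closedStrip τ ⊆ closure (strip τ \ Λ τ) := by
  rw [← closure_strip]
  refine closure_minimal ?_ isClosed_closure
  exact (countable_Λ.dense_compl ℝ).open_subset_closure_inter isOpen_strip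

@[simp] lemma γ_im (t : ℝ) : (γ τ t).im = τ.im / 2 := by simp [γ]

lemma γ_add_one (t : ℝ) : γ τ (t + 1) = γ τ t + 1 := by simp [γ, add_assoc]

lemma γ_add_int (t : ℝ) (m : ℤ) : γ τ (t + m) = γ τ t + m := by simp [γ, add_assoc]

lemma continuous_γ : Continuous (γ τ) := by unfold γ; fun_prop

lemma γ_notMem_Λ (t : ℝ) : γ τ t ∉ Λ τ := by
  intro h
  obtain ⟨m, n, h⟩ := mem_Λ.1 h
  have h := congrArg Complex.im h
  have := τ.im_pos
  simp at h
  have h2 : (n : ℝ) = 1 / 2 := by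
    field_simp at h ⊢
    nlinarith
  have : ((2 * n : ℤ) : ℝ) = (1 : ℤ) := by push_cast; linarith
  have := Int.cast_injective this
  omega

lemma strip_diff_subset_domain : strip τ \ Λ τ ⊆ domain τ := by
  rintro z ⟨hz, hl⟩
  refine ⟨hl, fun t _ h => ?_⟩
  obtain ⟨m, n, h⟩ := mem_Λ.1 h
  have h := congrArg Complex.im h
  have := τ.im_pos
  simp at h
  obtain ⟨h1, h2⟩ := hz
  have h3 : (n : ℝ) < 0 := by by_contra! h0; nlinarith
  have h4 : (-1 : ℝ) < n := by by_contra! h0; nlinarith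
  have h3 : n < 0 := by exact_mod_cast h3
  have h4 : -1 < n := by exact_mod_cast h4
  omega

lemma add_mem_domain {z l : ℂ} (hz : z ∈ domain τ) (hl : l ∈ Λ τ) : z + l ∈ domain τ := by
  refine ⟨fun h => hz.1 (by simpa using sub_mem h hl), fun t ht h => hz.2 t ht ?_⟩
  convert sub_mem h hl using 1
  ring

lemma neg_mem_domain {z : ℂ} (hz : z ∈ domain τ) : -z ∈ domain τ := by
  refine ⟨fun h => hz.1 (by simpa using neg_mem h), fun t ht h => ?_⟩
  -- The contour is symmetric modulo the lattice: `-γ(t) = γ(1 - t) - τ - 1`.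
  refine hz.2 (1 - t) ⟨by linarith [ht.2], by linarith [ht.1]⟩ ?_
  convert sub_mem (sub_mem (neg_mem h) τ_mem_Λ) (one_mem_Λ) using 1
  simp [γ]
  ring

lemma exists_add_mem_strip {z : ℂ} (hz : z ∈ domain τ) : ∃ l ∈ Λ τ, z + l ∈ strip τ \ Λ τ := by
  have hτ := τ.im_pos
  set k : ℤ := ⌈z.im / τ.im - 1 / 2⌉
  have h1 : z.im / τ.im - 1 / 2 ≤ k := Int.le_ceil _
  have h2 : (k : ℝ) < z.im / τ.im - 1 / 2 + 1 := Int.ceil_lt_add_one _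
  have h1 : z.im - τ.im / 2 ≤ k * τ.im := by
    have := mul_le_mul_of_nonneg_right h1 hτ.le
    rw [sub_mul, div_mul_cancel₀ _ hτ.ne'] at this
    linarith
  have h2 : k * τ.im < z.im + τ.im / 2 := by
    have := mul_lt_mul_of_pos_right h2 hτ
    rw [add_mul, sub_mul, div_mul_cancel₀ _ hτ.ne'] at this
    linarith
  have hl : (0 : ℂ) - k * (τ : ℂ) ∈ Λ τ := mem_Λ.2 ⟨0, -k, by simp⟩
  refine ⟨_, hl, ?_, (add_mem_domain hz hl).1⟩
  rw [mem_strip]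
  have him : (z + (0 - k * (τ : ℂ))).im = z.im - k * τ.im := by simp; ring
  rw [him]
  -- The ceiling leaves only the upper edge to exclude; there `z` would be congruent to a point of
  -- `γ`, whose parameter is a fractional part.
  refine ⟨by linarith, lt_of_le_of_ne (by linarith) fun h => ?_⟩
  set x := (z - k * (τ : ℂ) - (τ : ℂ) / 2).re with hx
  refine hz.2 (Int.fract x) ⟨Int.fract_nonneg _, (Int.fract_lt_one _).le⟩
    (mem_Λ.2 ⟨⌊x⌋, k, ?_⟩)
  have e : z - k * (τ : ℂ) - (τ : ℂ) / 2 = x := by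
    apply Complex.ext
    · simp [hx]
    · simp; linarith
  have : (x : ℂ) = (⌊x⌋ : ℂ) + (Int.fract x : ℝ) := by
    have := Int.floor_add_fract x
    exact_mod_cast this.symm
  rw [γ]
  linear_combination -this - e

lemma eventually_notMem_Λ : ∀ᶠ z in 𝓝[≠] (0 : ℂ), z ∉ Λ τ := by
  filter_upwards [nhdsWithin_le_nhds ((periods τ).compl_lattice_sdiff_singleton_mem_nhds 0),
    self_mem_nhdsWithin] with z h1 h2 h3
  exact h1 ⟨h3, h2⟩

lemma eventually_mem_strip_diff : ∀ᶠ z in 𝓝[≠] (0 : ℂ), z ∈ strip τ \ Λ τ := by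
  filter_upwards [nhdsWithin_le_nhds (isOpen_strip.mem_nhds zero_mem_strip),
    eventually_notMem_Λ (τ := τ)] with z h1 h2 using ⟨h1, h2⟩

lemma eventually_mem_domain : ∀ᶠ z in 𝓝[≠] (0 : ℂ), z ∈ domain τ :=
  eventually_mem_strip_diff.mono fun _ h => strip_diff_subset_domain h

/-! ### Sectionally analytic functions and the kernel of the cylinder -/

/-- `F` is a function on the torus, analytic off the contour and the origin, with limits
`P` and `M` on the contour from the left (above) and from the right (below). -/
structure Sectional (τ : UpperHalfPlane) (F : ℂ → ℂ) (P M : ℝ → ℂ) : Prop where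
  periodic : ∀ z ∈ domain τ, ∀ l ∈ Λ τ, F (z + l) = F z
  analytic : AnalyticOnNhd ℂ F (domain τ)
  above : ∀ t : ℝ, Tendsto F (𝓝[{z | (γ τ t).im < z.im}] (γ τ t)) (𝓝 (P t))
  below : ∀ t : ℝ, Tendsto F (𝓝[{z | z.im < (γ τ t).im}] (γ τ t)) (𝓝 (M t))

/-- The function `2πi / (e^{2πiz} - 1)`, with simple poles of residue one at the integers. -/
noncomputable def cotKernel (z : ℂ) : ℂ :=
  2 * Real.pi * Complex.I / (Complex.exp (2 * Real.pi * Complex.I * z) - 1)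

lemma cotKernel_add_one (z : ℂ) : cotKernel (z + 1) = cotKernel z := by
  simp [cotKernel, mul_add, Complex.exp_add, Complex.exp_two_pi_mul_I]

lemma exp_sub_one_ne_zero {z : ℂ} (h : ∀ m : ℤ, z ≠ m) :
    Complex.exp (2 * Real.pi * Complex.I * z) - 1 ≠ 0 := by
  intro h0
  obtain ⟨m, hm⟩ := Complex.exp_eq_one_iff.1 (sub_eq_zero.1 h0)
  apply h m
  have := Complex.two_pi_I_ne_zero
  apply mul_left_cancel₀ this
  linear_combination hm

lemma differentiableAt_cotKernel {z : ℂ} (h : ∀ m : ℤ, z ≠ m) : DifferentiableAt ℂ cotKernel z := by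
  unfold cotKernel
  exact (differentiableAt_const _).div (by fun_prop) (exp_sub_one_ne_zero h)

lemma continuousAt_cotKernel {z : ℂ} (h : ∀ m : ℤ, z ≠ m) : ContinuousAt cotKernel z :=
  (differentiableAt_cotKernel h).continuousAt

lemma ne_intCast_of_notMem_Λ {z : ℂ} (h : z ∉ Λ τ) (m : ℤ) : z ≠ m :=
  fun h' => h (h' ▸ intCast_mem_Λ m)

lemma tendsto_mul_cotKernel : Tendsto (fun z => z * cotKernel z) (𝓝[≠] 0) (𝓝 1) := by
  have hd : HasDerivAt (fun z : ℂ => Complex.exp (2 * Real.pi * Complex.I * z))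
      (2 * Real.pi * Complex.I) 0 := by
    have := ((hasDerivAt_id (0 : ℂ)).const_mul (2 * Real.pi * Complex.I)).cexp
    simpa using this
  have h2 := (hasDerivAt_iff_tendsto_slope.1 hd).inv₀ Complex.two_pi_I_ne_zero
  have h3 := h2.const_mul (2 * Real.pi * Complex.I)
  rw [mul_inv_cancel₀ Complex.two_pi_I_ne_zero] at h3
  refine h3.congr fun z => ?_
  simp only [slope, vsub_eq_sub, sub_zero, smul_eq_mul, mul_zero, Complex.exp_zero, mul_inv,
    inv_inv, cotKernel]
  ring

/-- As `t` runs over a period, `q = exp(2πi(z + t))` runs once around a circle centred at 0. -/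
lemma intervalIntegral_exp_eq_circleAverage (f : ℂ → ℂ) (z : ℂ) :
    ∫ t in (0 : ℝ)..1, f (Complex.exp (2 * Real.pi * Complex.I * (z + t))) =
      Real.circleAverage f 0 ‖Complex.exp (2 * Real.pi * Complex.I * z)‖ := by
  have hp := Real.two_pi_pos
  set θ := (2 * Real.pi * Complex.I * z).im
  have key : ∀ t : ℝ, Complex.exp (2 * Real.pi * Complex.I * (z + t)) =
      circleMap 0 ‖Complex.exp (2 * Real.pi * Complex.I * z)‖ (2 * Real.pi * t + θ) := by
    intro t
    rw [circleMap_zero, Complex.norm_exp, Complex.ofReal_exp, ← Complex.exp_add]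
    congr 1
    conv_lhs => rw [mul_add, ← Complex.re_add_im (2 * Real.pi * Complex.I * z)]
    push_cast
    ring
  simp_rw [key]
  rw [intervalIntegral.integral_comp_mul_add (fun s => f (circleMap 0 _ s)) hp.ne',
    Real.circleAverage]
  have hper : Function.Periodic
      (fun s => f (circleMap 0 ‖Complex.exp (2 * Real.pi * Complex.I * z)‖ s)) (2 * Real.pi) :=
    fun s => by simp only [periodic_circleMap _ _ s]
  have := hper.intervalIntegral_add_eq θ 0
  rw [zero_add] at this
  rw [← this, mul_zero, mul_one, zero_add, add_comm]

lemma norm_exp_two_pi_I (z : ℂ) :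
    ‖Complex.exp (2 * Real.pi * Complex.I * z)‖ = Real.exp (-(2 * Real.pi * z.im)) := by
  rw [Complex.norm_exp]; simp

/-- In the variable `q` the kernel is `2πi / (q - 1)`. The circle has radius less than one, so the
mean value is the value `-2πi` at the centre. -/
lemma integral_cotKernel_of_im_pos {z : ℂ} (hz : 0 < z.im) :
    ∫ t in (0 : ℝ)..1, cotKernel (z + t) = -(2 * Real.pi * Complex.I) := by
  have hp := Real.two_pi_pos
  refine (intervalIntegral_exp_eq_circleAverage
    (fun q => 2 * Real.pi * Complex.I / (q - 1)) z).trans ?_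
  rw [DiffContOnCl.circleAverage]
  · simp [div_neg]
  · apply DifferentiableOn.diffContOnCl
    intro q hq
    have hq := Metric.closure_ball_subset_closedBall hq
    rw [mem_closedBall_zero_iff, abs_of_nonneg (norm_nonneg _), norm_exp_two_pi_I] at hq
    have h1 : Real.exp (-(2 * Real.pi * z.im)) < 1 := by
      rw [Real.exp_lt_one_iff]; nlinarith
    refine ((differentiableAt_const _).div (by fun_prop) ?_).differentiableWithinAt
    intro h0
    rw [sub_eq_zero.1 h0] at hq
    simp at hq
    nlinarith

lemma cotKernel_neg (z : ℂ) (h : ∀ m : ℤ, z ≠ m) :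
    cotKernel (-z) = -(2 * Real.pi * Complex.I) - cotKernel z := by
  have h1 := exp_sub_one_ne_zero h
  have h2 := exp_sub_one_ne_zero (z := -z) fun m hm => h (-m) (by simp [← hm])
  have h3 := Complex.exp_ne_zero (2 * Real.pi * Complex.I * z)
  rw [mul_neg, Complex.exp_neg] at h2
  rw [cotKernel, cotKernel, mul_neg, Complex.exp_neg]
  generalize Complex.exp (2 * Real.pi * Complex.I * z) = w at h1 h2 h3 ⊢
  rw [eq_sub_iff_add_eq, div_add_div _ _ h2 h1, div_eq_iff (mul_ne_zero h2 h1)]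
  linear_combination (2 * Real.pi * Complex.I) * mul_inv_cancel₀ h3

lemma integral_cotKernel_of_im_neg {z : ℂ} (hz : z.im < 0) :
    ∫ t in (0 : ℝ)..1, cotKernel (z + t) = 0 := by
  have hne : ∀ t : ℝ, ∀ m : ℤ, z + t ≠ m := fun t m h => by
    have := congrArg Complex.im h
    simp at this
    linarith
  have hne' : ∀ t : ℝ, ∀ m : ℤ, -(z + t) ≠ m := fun t m h => hne t (-m) (by simp [← h])
  have h : ∀ t : ℝ, cotKernel (z + t) = -(2 * Real.pi * Complex.I) - cotKernel (-(z + t)) := by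
    intro t
    rw [cotKernel_neg _ (hne t)]
    ring
  have h0 : ∫ t in (0 : ℝ)..1, cotKernel (-(z + t)) = -(2 * Real.pi * Complex.I) := by
    have e : ∀ t : ℝ, cotKernel (-(z + t)) = (fun s : ℝ => cotKernel ((-z - 1) + s)) (1 - t) := by
      intro t
      simp only
      congr 1
      push_cast
      ring
    simp_rw [e]
    rw [intervalIntegral.integral_comp_sub_left (fun s : ℝ => cotKernel ((-z - 1) + s))]
    simpa using integral_cotKernel_of_im_pos (z := -z - 1) (by simpa using hz)
  simp_rw [h]
  rw [intervalIntegral.integral_sub, h0]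
  · simp
  · simp
  · apply Continuous.intervalIntegrable
    rw [continuous_iff_continuousAt]
    intro t
    exact (continuousAt_cotKernel (hne' t)).comp (f := fun t : ℝ => -(z + t))
      (by fun_prop)

/-! ### Extension to the closed strip -/

variable {F : ℂ → ℂ} {P M : ℝ → ℂ}

lemma Sectional.below_sub (hF : Sectional τ F P M) (t : ℝ) :
    Tendsto F (𝓝[strip τ \ Λ τ] (γ τ t)) (𝓝 (M t)) :=
  (hF.below t).mono_left (nhdsWithin_mono _ fun z hz => by
    rw [Set.mem_ofPred_eq, γ_im]; exact hz.1.2)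

/-- Translation by `τ` carries the lower edge of the strip to `γ`, approached from above. -/
lemma Sectional.above_sub (hF : Sectional τ F P M) (t : ℝ) :
    Tendsto F (𝓝[strip τ \ Λ τ] (γ τ t - τ)) (𝓝 (P t)) := by
  have h1 : Tendsto (fun z : ℂ => z + τ) (𝓝[strip τ \ Λ τ] (γ τ t - τ))
      (𝓝[{z | (γ τ t).im < z.im}] (γ τ t)) := by
    refine tendsto_nhdsWithin_iff.2 ⟨?_, ?_⟩
    · have : ContinuousAt (fun z : ℂ => z + τ) (γ τ t - τ) := by fun_prop
      simpa [ContinuousAt] using this.mono_left nhdsWithin_le_nhds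
    · filter_upwards [self_mem_nhdsWithin] with z hz
      have := hz.1.1
      simp only [γ_im, Complex.add_im, UpperHalfPlane.coe_im]
      linarith
  refine ((hF.above t).comp h1).congr' ?_
  filter_upwards [self_mem_nhdsWithin] with z hz
  exact hF.periodic z (strip_diff_subset_domain hz) _ τ_mem_Λ

lemma eq_γ_of_im {z : ℂ} (hz : z.im = τ.im / 2) : ∃ t : ℝ, z = γ τ t :=
  ⟨z.re - τ.re / 2, by apply Complex.ext <;> simp [γ, hz]⟩

lemma eq_γ_sub_of_im {z : ℂ} (hz : z.im = -(τ.im / 2)) : ∃ t : ℝ, z = γ τ t - τ :=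
  ⟨z.re + τ.re / 2, by apply Complex.ext <;> simp [γ, hz] <;> ring⟩

lemma γ_sub_notMem_Λ (t : ℝ) : γ τ t - τ ∉ Λ τ := fun h =>
  γ_notMem_Λ t (by simpa using add_mem h τ_mem_Λ)

lemma γ_mem_closedStrip (t : ℝ) : γ τ t ∈ closedStrip τ := by
  have := τ.im_pos
  rw [mem_closedStrip, γ_im]
  constructor <;> linarith

lemma γ_sub_mem_closedStrip (t : ℝ) : γ τ t - τ ∈ closedStrip τ := by
  have := τ.im_pos
  rw [mem_closedStrip, Complex.sub_im, γ_im, UpperHalfPlane.coe_im]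
  constructor <;> linarith

lemma eq_intCast_of_mem {z : ℂ} (hz : z ∈ strip τ) (hl : z ∈ Λ τ) : ∃ m : ℤ, z = m := by
  obtain ⟨m, n, rfl⟩ := mem_Λ.1 hl
  have := τ.im_pos
  obtain ⟨h1, h2⟩ := hz
  simp at h1 h2
  have h3 : (n : ℝ) < 1 := by by_contra! h0; nlinarith
  have h4 : (-1 : ℝ) < n := by by_contra! h0; nlinarith
  have h3 : n < 1 := by exact_mod_cast h3
  have h4 : -1 < n := by exact_mod_cast h4
  obtain rfl : n = 0 := by omega
  exact ⟨m, by simp⟩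

lemma isOpen_strip_diff : IsOpen (strip τ \ Λ τ) := isOpen_strip.sdiff isClosed_Λ

lemma add_int_mem_strip_diff {z : ℂ} (hz : z ∈ strip τ \ Λ τ) (m : ℤ) :
    z + m ∈ strip τ \ Λ τ := by
  refine ⟨?_, fun h => hz.2 (by simpa using sub_mem h (intCast_mem_Λ m))⟩
  have := hz.1
  rw [mem_strip] at this ⊢
  simpa using this

lemma tendsto_add_int (m : ℤ) (z : ℂ) : Tendsto (fun w => w + (m : ℂ))
    (𝓝[strip τ \ Λ τ] z) (𝓝[strip τ \ Λ τ] (z + m)) := by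
  refine tendsto_nhdsWithin_iff.2 ⟨?_, ?_⟩
  · have : ContinuousAt (fun w : ℂ => w + (m : ℂ)) z := by fun_prop
    exact this.mono_left nhdsWithin_le_nhds
  · filter_upwards [self_mem_nhdsWithin] with w hw using add_int_mem_strip_diff hw m

lemma nhdsWithin_strip_diff_zero : 𝓝[strip τ \ Λ τ] (0 : ℂ) = 𝓝[≠] 0 := by
  refine le_antisymm (nhdsWithin_mono _ fun z hz h0 => hz.2 (by simp_all)) ?_
  exact nhdsWithin_le_iff.2 eventually_mem_strip_diff

/-- A sectionally analytic function with a simple pole at the origin extends, once the pole is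
removed, continuously to the closed strip. -/
theorem Sectional.exists_extension (hF : Sectional τ F P M) {c : ℂ}
    (hc : Tendsto (fun z => z * F z) (𝓝[≠] 0) (𝓝 c)) :
    ∃ G : ℂ → ℂ, ContinuousOn G (closedStrip τ) ∧ DifferentiableOn ℂ G (strip τ) ∧
      (∀ z ∈ closedStrip τ, G (z + 1) = G z) ∧
      (∀ z ∈ strip τ \ Λ τ, G z = F z - c * cotKernel z) ∧
      (∀ t, G (γ τ t) = M t - c * cotKernel (γ τ t)) ∧
      (∀ t, G (γ τ t - τ) = P t - c * cotKernel (γ τ t - τ)) := by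
  set A := strip τ \ Λ τ
  set F₀ : ℂ → ℂ := fun z => F z - c * cotKernel z with hF₀
  have hsub : ∀ {z}, z ∈ closedStrip τ → z ∈ closure A := fun h => closedStrip_subset_closure h
  have hker : ∀ z ∉ Λ τ, Tendsto (fun z => c * cotKernel z) (𝓝[A] z) (𝓝 (c * cotKernel z)) :=
    fun z hz => (((continuousAt_cotKernel (ne_intCast_of_notMem_Λ hz)).const_mul c
      (f := cotKernel)).tendsto).mono_left nhdsWithin_le_nhds
  have htop : ∀ t, Tendsto F₀ (𝓝[A] (γ τ t)) (𝓝 (M t - c * cotKernel (γ τ t))) :=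
    fun t => (hF.below_sub t).sub (hker _ (γ_notMem_Λ t))
  have hbot : ∀ t, Tendsto F₀ (𝓝[A] (γ τ t - τ)) (𝓝 (P t - c * cotKernel (γ τ t - τ))) :=
    fun t => (hF.above_sub t).sub (hker _ (γ_sub_notMem_Λ t))
  have hdiff : ∀ z ∈ A, DifferentiableAt ℂ F₀ z := fun z hz =>
    (hF.analytic z (strip_diff_subset_domain hz)).differentiableAt.sub
      ((differentiableAt_cotKernel (ne_intCast_of_notMem_Λ hz.2)).const_mul c)
  have hint : ∀ z ∈ A, Tendsto F₀ (𝓝[A] z) (𝓝 (F₀ z)) := fun z hz =>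
    (hdiff z hz).continuousAt.tendsto.mono_left nhdsWithin_le_nhds
  have hzero : ∃ y, Tendsto F₀ (𝓝[A] 0) (𝓝 y) := by
    rw [nhdsWithin_strip_diff_zero]
    refine ⟨_, Complex.tendsto_limUnder_of_differentiable_on_punctured_nhds_of_isLittleO
      (eventually_mem_strip_diff.mono hdiff) ?_⟩
    have h1 : Tendsto (fun z => z * F₀ z) (𝓝[≠] 0) (𝓝 0) := by
      have := hc.sub (tendsto_mul_cotKernel.const_mul c)
      rw [mul_one, sub_self] at this
      refine this.congr fun z => ?_
      simp only [hF₀]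
      ring
    -- The removability criterion compares `F₀ z - F₀ 0` with `z⁻¹`; the arbitrary value `F₀ 0`
    -- contributes nothing in the limit.
    have h2 : Tendsto (fun z : ℂ => z * F₀ 0) (𝓝[≠] 0) (𝓝 0) := by
      have : ContinuousAt (fun z : ℂ => z * F₀ 0) 0 := by fun_prop
      simpa [ContinuousAt] using this.mono_left nhdsWithin_le_nhds
    refine (isLittleO_iff_tendsto' ?_).2 ?_
    · filter_upwards [self_mem_nhdsWithin] with z hz h0
      simp at h0
      exact absurd h0 hz
    · have := h1.sub h2
      rw [sub_zero] at this
      refine this.congr fun z => ?_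
      rw [sub_zero, div_inv_eq_mul]
      ring
  have hper : ∀ w ∈ A, ∀ m : ℤ, F₀ (w + m) = F₀ w := by
    intro w hw m
    have hk : ∀ m : ℤ, cotKernel (w + m) = cotKernel w := by
      intro m
      have hp : Function.Periodic cotKernel 1 := cotKernel_add_one
      simpa using hp.int_mul m w
    simp only [hF₀]
    rw [hF.periodic w (strip_diff_subset_domain hw) _ (intCast_mem_Λ m), hk]
  have hshift : ∀ z y, ∀ m : ℤ, Tendsto F₀ (𝓝[A] (z + m)) (𝓝 y) →
      Tendsto F₀ (𝓝[A] z) (𝓝 y) := by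
    intro z y m h
    refine (h.comp (tendsto_add_int m z)).congr' ?_
    filter_upwards [self_mem_nhdsWithin] with w hw using hper w hw m
  have hlim : ∀ z ∈ closedStrip τ, ∃ y, Tendsto F₀ (𝓝[A] z) (𝓝 y) := by
    intro z hz
    rcases eq_or_lt_of_le hz.1 with h1 | h1
    · obtain ⟨t, rfl⟩ := eq_γ_sub_of_im h1.symm
      exact ⟨_, hbot t⟩
    rcases eq_or_lt_of_le hz.2 with h2 | h2
    · obtain ⟨t, rfl⟩ := eq_γ_of_im h2
      exact ⟨_, htop t⟩
    by_cases hl : z ∈ Λ τ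
    · obtain ⟨m, rfl⟩ := eq_intCast_of_mem ⟨h1, h2⟩ hl
      obtain ⟨y, hy⟩ := hzero
      refine ⟨y, hshift _ _ (-m) ?_⟩
      simpa using hy
    · exact ⟨_, hint z ⟨⟨h1, h2⟩, hl⟩⟩
  have hG : ∀ z ∈ A, extendFrom A F₀ z = F₀ z := fun z hz =>
    extendFrom_eq (subset_closure hz) (hint z hz)
  have hcont : ContinuousOn (extendFrom A F₀) (closedStrip τ) :=
    continuousOn_extendFrom closedStrip_subset_closure hlim
  have hdA : ∀ z ∈ A, DifferentiableAt ℂ (extendFrom A F₀) z := fun z hz =>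
    (hdiff z hz).congr_of_eventuallyEq
      (by filter_upwards [isOpen_strip_diff.mem_nhds hz] with w hw using hG w hw)
  refine ⟨extendFrom A F₀, hcont, fun z hz => ?_, fun z hz => ?_, hG,
    fun t => extendFrom_eq (hsub (γ_mem_closedStrip t)) (htop t),
    fun t => extendFrom_eq (hsub (γ_sub_mem_closedStrip t)) (hbot t)⟩
  · refine DifferentiableAt.differentiableWithinAt ?_
    by_cases hl : z ∈ Λ τ
    · refine (Complex.analyticAt_of_differentiable_on_punctured_nhds_of_continuousAt ?_
        ((hcont.mono strip_subset_closedStrip).continuousAt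
          (isOpen_strip.mem_nhds hz))).differentiableAt
      filter_upwards [nhdsWithin_le_nhds (isOpen_strip.mem_nhds hz),
        nhdsWithin_le_nhds ((periods τ).compl_lattice_sdiff_singleton_mem_nhds z),
        self_mem_nhdsWithin] with w h1 h2 h3
      exact hdA w ⟨h1, fun h4 => h2 ⟨h4, h3⟩⟩
    · exact hdA z ⟨hz, hl⟩
  · have hz' : z + 1 ∈ closedStrip τ := by
      rw [mem_closedStrip] at hz ⊢
      simpa using hz
    obtain ⟨y, hy⟩ := hlim _ hz'
    rw [extendFrom_eq (hsub hz') hy, extendFrom_eq (hsub hz) (hshift z y 1 (by simpa using hy))]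

/-! ### Residue theorem and Liouville theorem on the torus -/

/-- A function analytic in the strip and of period one has the same integral over both edges. -/
theorem integral_edges_eq {G : ℂ → ℂ} (hc : ContinuousOn G (closedStrip τ))
    (hd : DifferentiableOn ℂ G (strip τ)) (hp : ∀ z ∈ closedStrip τ, G (z + 1) = G z) :
    ∫ t in (0 : ℝ)..1, G (γ τ t - τ) = ∫ t in (0 : ℝ)..1, G (γ τ t) := by
  have hτ := τ.im_pos
  set y := τ.im / 2 with hy
  have hy0 : -y ≤ y := by simp only [hy]; linarith
  -- The edges start at real parts `∓ re τ / 2`; periodicity moves both onto the sides of one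
  -- rectangle. Its vertical sides will cancel in Cauchy's theorem.
  have edge : ∀ b : ℝ, b ∈ Set.Icc (-y) y → ∀ s : ℝ,
      ∫ x in (0 : ℝ)..1, G ((x + s : ℝ) + b * Complex.I) =
        ∫ x in (0 : ℝ)..1, G (x + b * Complex.I) := by
    intro b hb s
    rw [intervalIntegral.integral_comp_add_right (fun x : ℝ => G (x + b * Complex.I))]
    have hper : Function.Periodic (fun x : ℝ => G (x + b * Complex.I)) 1 := by
      intro x
      simp only
      rw [← hp (x + b * Complex.I) (by rw [mem_closedStrip]; simpa using hb)]
      congr 1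
      push_cast
      ring
    have := hper.intervalIntegral_add_eq s 0
    rw [zero_add] at this
    rw [zero_add, ← this, add_comm]
  have e1 : ∀ t : ℝ, γ τ t - τ = ((t + -(τ.re / 2) : ℝ) : ℂ) + ((-y : ℝ) : ℂ) * Complex.I := by
    intro t
    apply Complex.ext
    all_goals simp [γ, hy]; ring
  have e2 : ∀ t : ℝ, γ τ t = ((t + τ.re / 2 : ℝ) : ℂ) + ((y : ℝ) : ℂ) * Complex.I := by
    intro t
    apply Complex.ext
    · simp [γ]; ring
    · simp [γ, hy]
  simp_rw [e1, e2]
  rw [edge _ ⟨le_rfl, hy0⟩, edge _ ⟨hy0, le_rfl⟩]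
  have h := Complex.integral_boundary_rect_eq_zero_of_continuousOn_of_differentiableOn G
    (((0 : ℝ) : ℂ) + ((-y : ℝ) : ℂ) * Complex.I) (((1 : ℝ) : ℂ) + ((y : ℝ) : ℂ) * Complex.I)
    (hc.mono ?_) (hd.mono ?_)
  · simp only [Complex.add_re, Complex.ofReal_re, Complex.mul_re, Complex.I_re, mul_zero,
      Complex.ofReal_im, Complex.I_im, mul_one, sub_self, add_zero, Complex.add_im,
      Complex.mul_im, zero_add, smul_eq_mul] at h
    simp only [Complex.ofReal_one, Complex.ofReal_zero, zero_add] at h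
    have hv : ∫ x in (-y)..y, G (1 + x * Complex.I) = ∫ x in (-y)..y, G (x * Complex.I) := by
      refine intervalIntegral.integral_congr fun x hx => ?_
      rw [Set.uIcc_of_le hy0] at hx
      rw [add_comm, hp]
      rw [mem_closedStrip]
      simpa using hx
    rw [hv] at h
    linear_combination h
  · rintro z ⟨-, hz⟩
    simp only [Complex.add_im, Complex.ofReal_im, Complex.mul_im, Complex.ofReal_re, Complex.I_im,
      mul_one, Complex.I_re, mul_zero, add_zero, zero_add, Set.mem_preimage] at hz
    rw [Set.uIcc_of_le hy0] at hz
    exact hz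
  · rintro z ⟨-, hz⟩
    simp only [Complex.add_im, Complex.ofReal_im, Complex.mul_im, Complex.ofReal_re, Complex.I_im,
      mul_one, Complex.I_re, mul_zero, add_zero, zero_add, Set.mem_preimage] at hz
    rw [min_eq_left hy0, max_eq_right hy0] at hz
    exact hz

lemma continuous_cotKernel_γ : Continuous fun t : ℝ => cotKernel (γ τ t) :=
  continuous_iff_continuousAt.2 fun t =>
    (continuousAt_cotKernel (ne_intCast_of_notMem_Λ (γ_notMem_Λ t))).comp
      continuous_γ.continuousAt

lemma continuous_cotKernel_γ_sub : Continuous fun t : ℝ => cotKernel (γ τ t - τ) :=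
  continuous_iff_continuousAt.2 fun t =>
    (continuousAt_cotKernel (ne_intCast_of_notMem_Λ (γ_sub_notMem_Λ t))).comp
      (f := fun t : ℝ => γ τ t - τ) (continuous_γ.sub continuous_const).continuousAt

/-- The residue theorem on the torus for a simple pole at the origin. -/
theorem Sectional.integral_jump (hF : Sectional τ F P M) {c : ℂ}
    (hc : Tendsto (fun z => z * F z) (𝓝[≠] 0) (𝓝 c)) :
    ∫ t in (0 : ℝ)..1, (P t - M t) = 2 * Real.pi * Complex.I * c := by
  have hτ := τ.im_pos
  obtain ⟨G, h1, h2, h3, -, h5, h6⟩ := hF.exists_extension hc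
  have hM : Continuous fun t => G (γ τ t) :=
    h1.comp_continuous continuous_γ γ_mem_closedStrip
  have hP : Continuous fun t => G (γ τ t - τ) :=
    h1.comp_continuous (continuous_γ.sub continuous_const) γ_sub_mem_closedStrip
  have k1 := continuous_cotKernel_γ (τ := τ)
  have k2 := continuous_cotKernel_γ_sub (τ := τ)
  have e : ∀ t, P t - M t = (G (γ τ t - τ) + c * cotKernel (γ τ t - τ)) -
      (G (γ τ t) + c * cotKernel (γ τ t)) := fun t => by rw [h5, h6]; ring
  have i1 : ∫ t in (0 : ℝ)..1, cotKernel (γ τ t) = -(2 * Real.pi * Complex.I) :=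
    integral_cotKernel_of_im_pos (by simpa using hτ)
  have i2 : ∫ t in (0 : ℝ)..1, cotKernel (γ τ t - τ) = 0 := by
    rw [← integral_cotKernel_of_im_neg (z := (τ : ℂ) / 2 - τ) (by simp; linarith)]
    refine intervalIntegral.integral_congr fun t _ => ?_
    simp only [γ]
    congr 1
    ring
  simp_rw [e]
  rw [intervalIntegral.integral_sub, intervalIntegral.integral_add,
    intervalIntegral.integral_add, intervalIntegral.integral_const_mul,
    intervalIntegral.integral_const_mul, i1, i2, integral_edges_eq h1 h2 h3]
  · ring
  · exact hM.intervalIntegrable _ _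
  · exact (k1.const_mul c).intervalIntegrable _ _
  · exact hP.intervalIntegrable _ _
  · exact (k2.const_mul c).intervalIntegrable _ _
  · exact (hP.add (k2.const_mul c)).intervalIntegrable _ _
  · exact (hM.add (k1.const_mul c)).intervalIntegrable _ _

/-- A single nonzero Fourier coefficient is trivially summable, so the series converges pointwise to
the function. -/
lemma continuous_const_of_fourierCoeff_eq_zero {p : ℝ → ℂ} (hp : Continuous p)
    (hper : Function.Periodic p 1)
    (h : ∀ k : ℤ, k ≠ 0 →
      ∫ t in (0 : ℝ)..1, Complex.exp (2 * Real.pi * Complex.I * k * t) * p t = 0) (t : ℝ) :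
    p t = p 0 := by
  have : Fact ((0 : ℝ) < 1) := ⟨one_pos⟩
  let f : C(AddCircle (1 : ℝ), ℂ) := ⟨hper.lift, continuous_coinduced_dom.2 hp⟩
  have hf : ∀ x : ℝ, f (x : AddCircle (1 : ℝ)) = p x := fun x => hper.lift_coe x
  have hco : ∀ k : ℤ, k ≠ 0 → fourierCoeff f k = 0 := by
    intro k hk
    rw [fourierCoeff_eq_intervalIntegral f k 0]
    rw [zero_add, div_one, one_smul, ← h (-k) (neg_ne_zero.2 hk)]
    refine intervalIntegral.integral_congr fun x _ => ?_
    rw [hf, fourier_coe_apply, smul_eq_mul, Complex.ofReal_one, div_one]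
  have hs : Summable (fourierCoeff f) :=
    summable_of_ne_finset_zero (s := {0}) fun k hk => hco k (by simpa using hk)
  have hx : ∀ x : AddCircle (1 : ℝ), f x = fourierCoeff f 0 := by
    intro x
    refine (has_pointwise_sum_fourier_series_of_summable hs x).unique ?_
    have := hasSum_single (f := fun i => fourierCoeff f i • (fourier i) x) 0
      (fun k hk => by rw [hco k hk, zero_smul])
    simpa using this
  rw [← hf, ← hf, hx, hx]

/-- Liouville's theorem on the torus: without a jump and without a pole at the origin, a
sectionally analytic function is constant. -/
theorem Sectional.exists_const (hF : Sectional τ F P P)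
    (hc : Tendsto (fun z => z * F z) (𝓝[≠] 0) (𝓝 0)) : ∃ c, ∀ z ∈ domain τ, F z = c := by
  have hτ := τ.im_pos
  obtain ⟨G, h1, h2, h3, h4, h5, h6⟩ := hF.exists_extension hc
  simp only [zero_mul, sub_zero] at h4 h5 h6
  have hP : Continuous P := by
    have := h1.comp_continuous continuous_γ γ_mem_closedStrip
    simpa only [Function.comp_def, h5] using this
  have hPp : Function.Periodic P 1 := fun t => by
    rw [← h5, ← h5, γ_add_one, h3 _ (γ_mem_closedStrip t)]
  -- Multiplying `G` by `exp(2πikz)` and equating the integrals over the two edges gives the same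
  -- Fourier coefficient `J` with factors `exp(∓πikτ)`. Their moduli differ for `k ≠ 0`, so `J = 0`.
  have hconst : ∀ t, P t = P 0 := by
    refine continuous_const_of_fourierCoeff_eq_zero hP hPp fun k hk => ?_
    set e : ℂ → ℂ := fun z => Complex.exp (2 * Real.pi * Complex.I * k * z) with he
    have hecont : Continuous e := by fun_prop
    have hediff : Differentiable ℂ e := by fun_prop
    have key := integral_edges_eq (τ := τ) (G := fun z => e z * G z)
      (hecont.continuousOn.mul h1) (hediff.differentiableOn.mul h2) (fun z hz => by
        rw [h3 z hz]
        congr 1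
        simp only [he]
        rw [mul_add, Complex.exp_add, mul_one, mul_comm _ (k : ℂ), Complex.exp_int_mul_two_pi_mul_I,
          mul_one])
    set J := ∫ t in (0 : ℝ)..1, Complex.exp (2 * Real.pi * Complex.I * k * t) * P t
    have a1 : ∫ t in (0 : ℝ)..1, e (γ τ t - τ) * G (γ τ t - τ) = e (-(τ : ℂ) / 2) * J := by
      rw [← intervalIntegral.integral_const_mul]
      refine intervalIntegral.integral_congr fun t _ => ?_
      simp only [h6]
      simp only [he, γ]
      rw [← mul_assoc, ← Complex.exp_add]
      congr 2
      ring
    have a2 : ∫ t in (0 : ℝ)..1, e (γ τ t) * G (γ τ t) = e ((τ : ℂ) / 2) * J := by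
      rw [← intervalIntegral.integral_const_mul]
      refine intervalIntegral.integral_congr fun t _ => ?_
      simp only [h5]
      simp only [he, γ]
      rw [← mul_assoc, ← Complex.exp_add]
      congr 2
      ring
    rw [a1, a2, ← sub_eq_zero, ← sub_mul] at key
    refine (mul_eq_zero.1 key).resolve_left fun h0 => ?_
    have h0 := congrArg norm (sub_eq_zero.1 h0)
    simp only [he, Complex.norm_exp] at h0
    have h0 := Real.exp_injective h0
    simp only [Complex.mul_re, Complex.mul_im, Complex.re_ofNat, Complex.im_ofNat,
      Complex.ofReal_re, Complex.ofReal_im, Complex.I_re, Complex.I_im, Complex.intCast_re,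
      Complex.intCast_im, Complex.neg_im, Complex.div_ofNat_im, UpperHalfPlane.coe_im] at h0
    have : (k : ℝ) ≠ 0 := by exact_mod_cast hk
    have hpi := Real.pi_pos
    have h7 : (2 * Real.pi * τ.im) * (k : ℝ) = 0 := by linarith
    exact this ((mul_eq_zero.1 h7).resolve_left (by positivity))
  have hstrip : ∀ z ∈ strip τ, G z = P 0 := by
    intro z hz
    have hbdd : ∃ B, ∀ z ∈ closedStrip τ, ‖G z‖ ≤ B := by
      have hcomp : IsCompact (Set.Icc (0 : ℝ) 1 ×ℂ Set.Icc (-(τ.im / 2)) (τ.im / 2)) :=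
        isCompact_Icc.reProdIm isCompact_Icc
      obtain ⟨B, hB⟩ := hcomp.exists_bound_of_continuousOn (h1.mono fun z hz => hz.2)
      have hint : ∀ z ∈ closedStrip τ, ∀ m : ℕ, G (z + m) = G z := by
        intro z hz m
        induction m with
        | zero => simp
        | succ m ih =>
          rw [← ih, ← h3 (z + m)]
          · push_cast; ring_nf
          · rw [mem_closedStrip] at hz ⊢; simpa using hz
      have hint' : ∀ z ∈ closedStrip τ, ∀ m : ℤ, G (z + m) = G z := by
        intro z hz m
        obtain ⟨k, rfl | rfl⟩ := m.eq_nat_or_neg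
        · exact_mod_cast hint z hz k
        · rw [← hint (z + _) (by rw [mem_closedStrip] at hz ⊢; simpa using hz) k]
          simp
      refine ⟨B, fun z hz => ?_⟩
      rw [← hint' z hz (-⌊z.re⌋)]
      apply hB
      refine ⟨?_, by simpa [mem_closedStrip] using hz⟩
      have i1 := Int.floor_le z.re
      have i2 := (Int.lt_floor_add_one z.re).le
      simp
      constructor <;> linarith
    obtain ⟨B, hB⟩ := hbdd
    have h0 : ‖G z - P 0‖ ≤ 0 := by
      -- `G` is bounded, by compactness of one period, and equals `P 0` on both edges. The growth
      -- exponents can thus be taken to be zero.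
      refine PhragmenLindelof.horizontal_strip (f := fun z => G z - P 0) (a := -(τ.im / 2))
        (b := τ.im / 2) ?_ ?_ ?_ ?_ hz.1.le hz.2.le
      · refine ⟨h2.sub_const _, ?_⟩
        exact ContinuousOn.sub (by rw [← strip, closure_strip]; exact h1) continuousOn_const
      · refine ⟨0, by have := Real.pi_pos; apply div_pos <;> linarith, 0, ?_⟩
        refine IsBigO.of_bound (B + ‖P 0‖) ?_
        filter_upwards [mem_inf_of_right (mem_principal_self _)] with w hw
        simp only [zero_mul, Real.exp_zero, norm_one, mul_one]
        exact (norm_sub_le _ _).trans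
          (add_le_add_left (hB w (strip_subset_closedStrip hw)) _)
      · intro w hw
        obtain ⟨t, rfl⟩ := eq_γ_sub_of_im hw
        simp [h6, hconst t]
      · intro w hw
        obtain ⟨t, rfl⟩ := eq_γ_of_im hw
        simp [h5, hconst t]
    exact sub_eq_zero.1 (norm_le_zero_iff.1 h0)
  refine ⟨P 0, fun z hz => ?_⟩
  obtain ⟨l, hl, hm⟩ := exists_add_mem_strip hz
  rw [← hF.periodic z hz l hl, ← h4 _ hm, hstrip _ hm.1]

/-! ### Operations on sectionally analytic functions -/

variable {G : ℂ → ℂ} {P' M' : ℝ → ℂ}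

lemma Sectional.mul (hF : Sectional τ F P M) (hG : Sectional τ G P' M') :
    Sectional τ (fun z => F z * G z) (fun t => P t * P' t) (fun t => M t * M' t) where
  periodic z hz l hl := by rw [hF.periodic z hz l hl, hG.periodic z hz l hl]
  analytic z hz := (hF.analytic z hz).mul (hG.analytic z hz)
  above t := (hF.above t).mul (hG.above t)
  below t := (hF.below t).mul (hG.below t)

lemma Sectional.sub (hF : Sectional τ F P M) (hG : Sectional τ G P' M') :
    Sectional τ (fun z => F z - G z) (fun t => P t - P' t) (fun t => M t - M' t) where
  periodic z hz l hl := by rw [hF.periodic z hz l hl, hG.periodic z hz l hl]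
  analytic z hz := (hF.analytic z hz).sub (hG.analytic z hz)
  above t := (hF.above t).sub (hG.above t)
  below t := (hF.below t).sub (hG.below t)

lemma Sectional.const_mul (hF : Sectional τ F P M) (c : ℂ) :
    Sectional τ (fun z => c * F z) (fun t => c * P t) (fun t => c * M t) where
  periodic z hz l hl := by rw [hF.periodic z hz l hl]
  analytic z hz := analyticAt_const.mul (hF.analytic z hz)
  above t := (hF.above t).const_mul c
  below t := (hF.below t).const_mul c

lemma mem_domain_of_im {z : ℂ} (h1 : 0 < z.im) (h2 : z.im < τ.im) (h3 : z.im ≠ τ.im / 2) :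
    z ∈ domain τ := by
  rcases lt_or_gt_of_ne h3 with h | h
  · by_cases hl : z ∈ Λ τ
    · obtain ⟨m, rfl⟩ := eq_intCast_of_mem ⟨by linarith, h⟩ hl
      simp at h1
    · exact strip_diff_subset_domain ⟨⟨by linarith, h⟩, hl⟩
  · have hs : z - τ ∈ strip τ := by
      rw [mem_strip, Complex.sub_im, UpperHalfPlane.coe_im]
      constructor <;> linarith
    by_cases hl : z - τ ∈ Λ τ
    · obtain ⟨m, hm⟩ := eq_intCast_of_mem hs hl
      have := congrArg Complex.im hm
      simp at this
      linarith
    · simpa using add_mem_domain (strip_diff_subset_domain ⟨hs, hl⟩) τ_mem_Λ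

lemma eventually_im_γ (t : ℝ) : ∀ᶠ z in 𝓝 (γ τ t), 0 < z.im ∧ z.im < τ.im := by
  have := τ.im_pos
  have h : (γ τ t).im ∈ Set.Ioo 0 τ.im := by
    rw [γ_im]; constructor <;> linarith
  exact Complex.continuous_im.continuousAt.eventually (Ioo_mem_nhds h.1 h.2)

lemma eventually_mem_domain_above (t : ℝ) :
    ∀ᶠ z in 𝓝[{z | (γ τ t).im < z.im}] (γ τ t), z ∈ domain τ := by
  filter_upwards [self_mem_nhdsWithin, nhdsWithin_le_nhds (eventually_im_γ t)] with z hz hz'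
  simp only [γ_im] at hz
  exact mem_domain_of_im hz'.1 hz'.2 hz.ne'

lemma eventually_mem_domain_below (t : ℝ) :
    ∀ᶠ z in 𝓝[{z | z.im < (γ τ t).im}] (γ τ t), z ∈ domain τ := by
  filter_upwards [self_mem_nhdsWithin, nhdsWithin_le_nhds (eventually_im_γ t)] with z hz hz'
  simp only [γ_im] at hz
  exact mem_domain_of_im hz'.1 hz'.2 hz.ne

/-- Since `-γ(t) = γ(-t) - τ`, reflection preserves the contour modulo the lattice and exchanges its
two sides. -/
lemma Sectional.comp_neg (hF : Sectional τ F P M) :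
    Sectional τ (fun z => F (-z)) (fun t => M (-t)) (fun t => P (-t)) := by
  have hγ : ∀ t, -γ τ t = γ τ (-t) - τ := fun t => by simp [γ]; ring
  have hcont : ∀ t, Tendsto (fun z : ℂ => -z + τ) (𝓝 (γ τ t)) (𝓝 (γ τ (-t))) := fun t => by
    have : ContinuousAt (fun z : ℂ => -z + τ) (γ τ t) := by fun_prop
    simpa [ContinuousAt, hγ] using this
  refine ⟨fun z hz l hl => ?_, fun z hz => ?_, fun t => ?_, fun t => ?_⟩
  · rw [neg_add]
    exact hF.periodic _ (neg_mem_domain hz) _ (neg_mem hl)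
  · exact (hF.analytic _ (neg_mem_domain hz)).comp_of_eq analyticAt_id.neg rfl
  · have h1 : Tendsto (fun z : ℂ => -z + τ) (𝓝[{z | (γ τ t).im < z.im}] (γ τ t))
        (𝓝[{z | z.im < (γ τ (-t)).im}] (γ τ (-t))) := by
      refine tendsto_nhdsWithin_iff.2 ⟨(hcont t).mono_left nhdsWithin_le_nhds, ?_⟩
      filter_upwards [self_mem_nhdsWithin] with z hz
      simp at hz ⊢
      linarith
    refine ((hF.below (-t)).comp h1).congr' ?_
    filter_upwards [eventually_mem_domain_above t] with z hz
    exact hF.periodic _ (neg_mem_domain hz) _ τ_mem_Λ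
  · have h1 : Tendsto (fun z : ℂ => -z + τ) (𝓝[{z | z.im < (γ τ t).im}] (γ τ t))
        (𝓝[{z | (γ τ (-t)).im < z.im}] (γ τ (-t))) := by
      refine tendsto_nhdsWithin_iff.2 ⟨(hcont t).mono_left nhdsWithin_le_nhds, ?_⟩
      filter_upwards [self_mem_nhdsWithin] with z hz
      simp at hz ⊢
      linarith
    refine ((hF.above (-t)).comp h1).congr' ?_
    filter_upwards [eventually_mem_domain_below t] with z hz
    exact hF.periodic _ (neg_mem_domain hz) _ τ_mem_Λ

lemma Sectional.limits_unique (hF : Sectional τ F P M) (hG : Sectional τ G P' M')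
    (h : ∀ z ∈ domain τ, F z = G z) : P = P' ∧ M = M' := by
  constructor
  · funext t
    have := mem_closure_iff_nhdsWithin_neBot.1
      (closedStrip_subset_closure (γ_sub_mem_closedStrip (τ := τ) t))
    refine tendsto_nhds_unique (hF.above_sub t) ((hG.above_sub t).congr' ?_)
    filter_upwards [self_mem_nhdsWithin] with z hz using (h z (strip_diff_subset_domain hz)).symm
  · funext t
    have := mem_closure_iff_nhdsWithin_neBot.1
      (closedStrip_subset_closure (γ_mem_closedStrip (τ := τ) t))
    refine tendsto_nhds_unique (hF.below_sub t) ((hG.below_sub t).congr' ?_)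
    filter_upwards [self_mem_nhdsWithin] with z hz using (h z (strip_diff_subset_domain hz)).symm

lemma Sectional.of_analytic {f : ℂ → ℂ} (hp : ∀ z, ∀ l ∈ Λ τ, f (z + l) = f z)
    (ha : ∀ z ∉ Λ τ, AnalyticAt ℂ f z) :
    Sectional τ f (fun t => f (γ τ t)) (fun t => f (γ τ t)) where
  periodic z _ l hl := hp z l hl
  analytic z hz := ha z hz.1
  above t := (ha _ (γ_notMem_Λ t)).continuousAt.tendsto.mono_left nhdsWithin_le_nhds
  below t := (ha _ (γ_notMem_Λ t)).continuousAt.tendsto.mono_left nhdsWithin_le_nhds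

/-! ### Leading terms at the origin -/

/-- `F(z) = z ^ k (c + O(z))` near the origin, with an analytic factor. -/
def Lead (k : ℤ) (c : ℂ) (F : ℂ → ℂ) : Prop :=
  ∃ g : ℂ → ℂ, AnalyticAt ℂ g 0 ∧ g 0 = c ∧ ∀ᶠ z in 𝓝[≠] 0, F z = z ^ k * g z

section Lead

variable {k l : ℤ} {c d : ℂ}

lemma eventually_ne_zero : ∀ᶠ z : ℂ in 𝓝[≠] 0, z ≠ 0 := self_mem_nhdsWithin

lemma Lead.congr (h : Lead k c F) (e : ∀ᶠ z in 𝓝[≠] 0, F z = G z) : Lead k c G := by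
  obtain ⟨g, h1, h2, h3⟩ := h
  refine ⟨g, h1, h2, ?_⟩
  filter_upwards [e, h3] with z e h3
  rw [← e, h3]

lemma Lead.mul (hF : Lead k c F) (hG : Lead l d G) : Lead (k + l) (c * d) (fun z => F z * G z) := by
  obtain ⟨f, h1, h2, h3⟩ := hF
  obtain ⟨g, h4, h5, h6⟩ := hG
  refine ⟨fun z => f z * g z, h1.mul h4, by simp [h2, h5], ?_⟩
  filter_upwards [h3, h6, eventually_ne_zero] with z h3 h6 h0
  rw [h3, h6, zpow_add₀ h0]
  ring

lemma Lead.sub (hF : Lead k c F) (hG : Lead k d G) : Lead k (c - d) (fun z => F z - G z) := by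
  obtain ⟨f, h1, h2, h3⟩ := hF
  obtain ⟨g, h4, h5, h6⟩ := hG
  refine ⟨fun z => f z - g z, h1.sub h4, by simp [h2, h5], ?_⟩
  filter_upwards [h3, h6] with z h3 h6
  rw [h3, h6]
  ring

lemma Lead.add (hF : Lead k c F) (hG : Lead k d G) : Lead k (c + d) (fun z => F z + G z) := by
  obtain ⟨f, h1, h2, h3⟩ := hF
  obtain ⟨g, h4, h5, h6⟩ := hG
  refine ⟨fun z => f z + g z, h1.add h4, by simp [h2, h5], ?_⟩
  filter_upwards [h3, h6] with z h3 h6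
  rw [h3, h6]
  ring

lemma Lead.const (c : ℂ) : Lead 0 c fun _ => c :=
  ⟨fun _ => c, analyticAt_const, rfl, by simp⟩

lemma Lead.const_mul (hF : Lead k c F) (d : ℂ) : Lead k (d * c) (fun z => d * F z) := by
  simpa using (Lead.const d).mul hF

lemma Lead.pow (hF : Lead k c F) (m : ℕ) : Lead (m * k) (c ^ m) (fun z => F z ^ m) := by
  induction m with
  | zero => simpa using Lead.const 1
  | succ m ih =>
    have := ih.mul hF
    simpa only [pow_succ, Nat.cast_succ, add_mul, one_mul] using this

lemma exists_eq_mul_of_analyticAt {g : ℂ → ℂ} (hg : AnalyticAt ℂ g 0) (h0 : g 0 = 0) :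
    ∃ g₁, AnalyticAt ℂ g₁ 0 ∧ ∀ z, g z = z * g₁ z := by
  refine ⟨dslope g 0, ?_, fun z => ?_⟩
  · obtain ⟨p, hp⟩ := hg
    exact ⟨_, hp.has_fpower_series_dslope_fslope⟩
  · have := sub_smul_dslope g 0 z
    simpa [h0] using this.symm

/-- Turns a cancellation of leading terms into one more order at the origin; the new coefficient is
left unspecified. -/
lemma Lead.succ (hF : Lead k 0 F) : ∃ d, Lead (k + 1) d F := by
  obtain ⟨f, h1, h2, h3⟩ := hF
  obtain ⟨g, h4, h5⟩ := exists_eq_mul_of_analyticAt h1 h2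
  refine ⟨g 0, g, h4, rfl, ?_⟩
  filter_upwards [h3, eventually_ne_zero] with z h3 h0
  rw [h3, h5, zpow_add_one₀ h0, mul_assoc]

lemma Lead.of_lt (hF : Lead k c F) (h : l < k) : Lead l 0 F := by
  obtain ⟨f, h1, h2, h3⟩ := hF
  obtain ⟨m, rfl⟩ : ∃ m : ℕ, k = l + (m + 1) := ⟨(k - l - 1).toNat, by omega⟩
  refine ⟨fun z => z ^ (m + 1) * f z, (analyticAt_id.pow _).mul h1, by simp, ?_⟩
  filter_upwards [h3, eventually_ne_zero] with z h3 h0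
  rw [h3, zpow_add₀ h0]
  simp only [← mul_assoc]
  norm_cast

lemma Lead.tendsto (hF : Lead k c F) : Tendsto (fun z => z ^ (-k) * F z) (𝓝[≠] 0) (𝓝 c) := by
  obtain ⟨f, h1, rfl, h3⟩ := hF
  refine (h1.continuousAt.tendsto.mono_left nhdsWithin_le_nhds).congr' ?_
  filter_upwards [h3, eventually_ne_zero] with z h3 h0
  rw [h3, ← mul_assoc, ← zpow_add₀ h0, neg_add_cancel, zpow_zero, one_mul]

lemma tendsto_neg_punctured : Tendsto (fun z : ℂ => -z) (𝓝[≠] 0) (𝓝[≠] 0) := by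
  refine tendsto_nhdsWithin_iff.2 ⟨?_, ?_⟩
  · have : ContinuousAt (fun z : ℂ => -z) 0 := by fun_prop
    simpa [ContinuousAt] using this.mono_left nhdsWithin_le_nhds
  · filter_upwards [eventually_ne_zero] with z hz
    simpa using hz

lemma Lead.comp_neg (hF : Lead k c F) : Lead k ((-1) ^ k * c) (fun z => F (-z)) := by
  obtain ⟨f, h1, rfl, h3⟩ := hF
  refine ⟨fun z => (-1) ^ k * f (-z), ?_, by simp, ?_⟩
  · exact analyticAt_const.mul (AnalyticAt.comp_of_eq h1 analyticAt_id.neg (by simp))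
  · filter_upwards [tendsto_neg_punctured.eventually h3] with z h3
    rw [h3, neg_eq_neg_one_mul z, mul_zpow]
    ring

lemma Lead.unique (hF : Lead k c F) (hG : Lead k d F) : c = d :=
  tendsto_nhds_unique hF.tendsto hG.tendsto

lemma Lead.tendsto_mul (hF : Lead (-1) c F) : Tendsto (fun z => z * F z) (𝓝[≠] 0) (𝓝 c) := by
  simpa using hF.tendsto

/-- The bound makes the singularity of `z ^ (-k) * F z` removable, with value `c`. -/
lemma lead_of_bounded (ha : ∀ᶠ z in 𝓝[≠] 0, DifferentiableAt ℂ F z)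
    (hb : (fun z : ℂ => z ^ (-k) * F z - c) =O[𝓝[≠] 0] fun z : ℂ => z) : Lead k c F := by
  set g : ℂ → ℂ := Function.update (fun z => z ^ (-k) * F z) 0 c with hg
  have he : ∀ z ≠ 0, g z = z ^ (-k) * F z := fun z hz => by simp [hg, hz]
  have hlim : Tendsto (fun z : ℂ => z ^ (-k) * F z) (𝓝[≠] 0) (𝓝 c) := by
    have h1 := hb.trans_tendsto (tendsto_id.mono_left nhdsWithin_le_nhds)
    simpa using h1.add_const c
  have hc : ContinuousAt g 0 := by
    rw [hg, continuousAt_update_same]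
    exact hlim
  refine ⟨g, Complex.analyticAt_of_differentiable_on_punctured_nhds_of_continuousAt ?_ hc,
    by simp [hg], ?_⟩
  · filter_upwards [ha, eventually_ne_zero] with z hz h0
    refine ((differentiableAt_zpow.2 (Or.inl h0)).mul hz).congr_of_eventuallyEq
      (f := fun z : ℂ => z ^ (-k) * F z) ?_
    filter_upwards [isOpen_ne.mem_nhds h0] with w hw using he w hw
  · filter_upwards [eventually_ne_zero] with z h0
    rw [he z h0, ← mul_assoc, ← zpow_add₀ h0, add_neg_cancel, zpow_zero, one_mul]

/-- A function of definite parity has no term of relative order one. -/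
lemma Lead.expansion_of_parity (hF : Lead k c F) {s : ℂ} (hs : s * (-1) ^ k = 1)
    (hp : ∀ᶠ z in 𝓝[≠] 0, F z = s * F (-z)) :
    ∃ u : ℂ → ℂ, AnalyticAt ℂ u 0 ∧ ∀ᶠ z in 𝓝[≠] 0, F z = z ^ k * (c + z ^ 2 * u z) := by
  obtain ⟨f, h1, h2, h3⟩ := hF
  obtain ⟨g, h4, h5⟩ := exists_eq_mul_of_analyticAt (h1.sub (analyticAt_const (v := c)))
    (by simp [h2])
  have h5 : ∀ z, f z = c + z * g z := fun z => by rw [← h5 z]; simp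
  have hneg := tendsto_neg_punctured
  -- Parity of `F` makes the relative remainder `g` odd, which forces `g 0 = 0`.
  have hg : ∀ᶠ z in 𝓝[≠] 0, g z = - g (-z) := by
    filter_upwards [h3, hneg.eventually h3, hp, eventually_ne_zero] with z e1 e2 e3 h0
    rw [e1, e2, h5, h5, neg_eq_neg_one_mul z, mul_zpow, ← neg_eq_neg_one_mul] at e3
    have e4 : z ^ k * (c + z * g z) = z ^ k * (c + -z * g (-z)) := by
      rw [e3]
      linear_combination (z ^ k * (c + -z * g (-z))) * hs
    have e5 := mul_left_cancel₀ (zpow_ne_zero k h0) e4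
    apply mul_left_cancel₀ h0
    linear_combination e5
  have hg0 : g 0 = 0 := by
    have t1 : Tendsto g (𝓝[≠] 0) (𝓝 (g 0)) :=
      h4.continuousAt.tendsto.mono_left nhdsWithin_le_nhds
    have := tendsto_nhds_unique (t1.congr' hg) (t1.comp hneg).neg
    have h2 : 2 * g 0 = 0 := by linear_combination this
    simpa using h2
  obtain ⟨u, h6, h7⟩ := exists_eq_mul_of_analyticAt h4 hg0
  refine ⟨u, h6, ?_⟩
  filter_upwards [h3] with z h3
  rw [h3, h5, h7]
  ring

lemma isBigO_of_expansion {u : ℂ → ℂ} (hu : AnalyticAt ℂ u 0)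
    (h : ∀ᶠ z in 𝓝[≠] 0, F z = z ^ k * (c + z ^ 2 * u z)) :
    (fun z : ℂ => z ^ (-k) * F z - (c + u 0 * z ^ 2)) =O[𝓝[≠] 0] fun z : ℂ => z ^ 3 := by
  obtain ⟨g, h4, h5⟩ := exists_eq_mul_of_analyticAt (hu.sub (analyticAt_const (v := u 0)))
    (by simp)
  have hb : (fun z : ℂ => z ^ 3 * g z) =O[𝓝[≠] 0] fun z : ℂ => z ^ 3 := by
    have : g =O[𝓝[≠] 0] fun _ => (1 : ℂ) :=
      (h4.continuousAt.tendsto.mono_left nhdsWithin_le_nhds).isBigO_one ℂ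
    simpa using (isBigO_refl (fun z : ℂ => z ^ 3) (𝓝[≠] 0)).mul this
  refine hb.congr' ?_ EventuallyEq.rfl
  filter_upwards [h, eventually_ne_zero] with z h h0
  rw [h, ← mul_assoc, ← zpow_add₀ h0, neg_add_cancel, zpow_zero]
  have := h5 z
  simp only [Pi.sub_apply] at this
  linear_combination (-z ^ 2) * this

end Lead

/-! ### Elliptic polynomials -/

lemma E_add (j : ℕ) (z : ℂ) (l : ℂ) (hl : l ∈ Λ τ) : E τ j (z + l) = E τ j z := by
  have h1 : wp τ (z + l) = wp τ z := (periods τ).weierstrassP_add_coe z ⟨l, hl⟩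
  have h2 : wp' τ (z + l) = wp' τ z := (periods τ).derivWeierstrassP_add_coe z ⟨l, hl⟩
  simp only [E, h1, h2]

lemma analyticAt_wp {z : ℂ} (hz : z ∉ Λ τ) : AnalyticAt ℂ (wp τ) z :=
  (periods τ).analyticOnNhd_weierstrassP z hz

lemma analyticAt_wp' {z : ℂ} (hz : z ∉ Λ τ) : AnalyticAt ℂ (wp' τ) z :=
  (periods τ).analyticOnNhd_derivWeierstrassP z hz

lemma analyticAt_E (j : ℕ) {z : ℂ} (hz : z ∉ Λ τ) : AnalyticAt ℂ (E τ j) z := by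
  have h1 := analyticAt_wp hz
  have h2 := analyticAt_wp' hz
  unfold E
  split_ifs
  · exact h1.pow _
  · exact (analyticAt_const.mul h2).mul (h1.pow _)

lemma E_neg {j : ℕ} (z : ℂ) : E τ j (-z) = (-1) ^ j * E τ j z := by
  have h1 : wp τ (-z) = wp τ z := (periods τ).weierstrassP_neg z
  have h2 : wp' τ (-z) = -wp' τ z := (periods τ).derivWeierstrassP_neg z
  simp only [E, h1, h2]
  split_ifs with h
  · rw [h.neg_one_pow, one_mul]
  · rw [(Nat.not_even_iff_odd.1 h).neg_one_pow]
    ring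

lemma E_zero : E τ 0 = fun _ => 1 := by
  funext z
  simp [E]

lemma E_two : E τ 2 = wp τ := by
  funext z
  simp [E]

lemma E_three (z : ℂ) : E τ 3 z = -(wp' τ z) / 2 := by
  simp [E, show ¬ Even 3 by decide]
  ring

/-- The absence of a constant term in `℘` is what lets `α` be read directly from the expansion of
the determinant. -/
lemma lead_wp_sub : Lead 0 0 (fun z => wp τ z - z ^ (-2 : ℤ)) := by
  refine ⟨_, (periods τ).analyticAt_weierstrassPExcept 0, by simp, ?_⟩
  filter_upwards with z
  have := (periods τ).weierstrassPExcept_def ⟨0, zero_mem _⟩ z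
  simp only [sub_zero] at this
  rw [wp, zpow_zero, one_mul, this]
  simp [zpow_neg, sub_eq_add_neg]

lemma lead_zpow (k : ℤ) : Lead k 1 (fun z : ℂ => z ^ k) :=
  ⟨fun _ => 1, analyticAt_const, rfl, by simp⟩

lemma lead_wp : Lead (-2) 1 (wp τ) := by
  have := ((lead_wp_sub (τ := τ)).of_lt (l := -2) (by norm_num)).add (lead_zpow (-2))
  simpa using this

lemma lead_wp' : Lead (-3) (-2) (wp' τ) := by
  have h1 : Lead 0 0 (fun z => wp' τ z - (-2) * z ^ (-3 : ℤ)) := by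
    refine ⟨_, (periods τ).analyticAt_derivWeierstrassPExcept 0, by simp, ?_⟩
    filter_upwards with z
    have := (periods τ).derivWeierstrassPExcept_def ⟨0, zero_mem _⟩ z
    simp only [sub_zero] at this
    rw [wp', zpow_zero, one_mul, this, zpow_neg, zpow_ofNat]
    ring
  have := (h1.of_lt (l := -3) (by norm_num)).add ((lead_zpow (-3)).const_mul (-2))
  simpa using this

/-- The factor `-1/2` makes the odd elements monic. At `j = 1`, truncated subtraction gives `E 1 = E
3`, with a triple pole. -/
lemma lead_E {j : ℕ} (hj : j ≠ 1) : Lead (-j) 1 (E τ j) := by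
  rcases Nat.even_or_odd j with h | h
  · have e : E τ j = fun z => wp τ z ^ (j / 2) := by funext z; simp [E, h]
    rw [e]
    have := (lead_wp (τ := τ)).pow (j / 2)
    obtain ⟨m, rfl⟩ := h
    convert this using 1
    · omega
    · simp
  · have e : E τ j = fun z => (-(1 / 2) * wp' τ z) * wp τ z ^ ((j - 3) / 2) := by
      funext z; simp [E, Nat.not_even_iff_odd.2 h]
    rw [e]
    have := ((lead_wp' (τ := τ)).const_mul (-(1 / 2))).mul ((lead_wp (τ := τ)).pow ((j - 3) / 2))
    obtain ⟨m, rfl⟩ := h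
    convert this using 1
    · omega
    · simp

variable (τ) in
/-- The elliptic polynomial with coefficients `a`, on the degrees in `S`. -/
noncomputable def ellipticPoly (S : Finset ℕ) (a : ℕ → ℂ) (z : ℂ) : ℂ := ∑ j ∈ S, a j * E τ j z

lemma sectional_ellipticPoly (S : Finset ℕ) (a : ℕ → ℂ) :
    Sectional τ (ellipticPoly τ S a) (fun t => ellipticPoly τ S a (γ τ t))
      (fun t => ellipticPoly τ S a (γ τ t)) := by
  refine .of_analytic (fun z l hl => ?_) (fun z hz => ?_)
  · simp only [ellipticPoly, E_add _ _ _ hl]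
  · exact Finset.analyticAt_fun_sum _ fun j _ => analyticAt_const.mul (analyticAt_E j hz)

lemma sectional_E (j : ℕ) :
    Sectional τ (E τ j) (fun t => E τ j (γ τ t)) (fun t => E τ j (γ τ t)) :=
  .of_analytic (fun z l hl => E_add j z l hl) (fun _ hz => analyticAt_E j hz)

lemma Lead.exists_const (hF : Sectional τ F P P) {c : ℂ} (h : Lead 0 c F) :
    ∀ z ∈ domain τ, F z = c := by
  obtain ⟨d, hd⟩ := hF.exists_const (h.of_lt (l := -1) (by norm_num)).tendsto_mul
  have : Lead 0 d F := (Lead.const d).congr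
    (eventually_mem_domain.mono fun z hz => (hd z hz).symm)
  rw [h.unique this]
  exact hd

/-- Elliptic functions with a pole of order at most `k` at the origin are elliptic polynomials of
degree at most `k`. -/
theorem Sectional.exists_ellipticPoly (k : ℕ) : ∀ {F : ℂ → ℂ} {P : ℝ → ℂ} {c : ℂ},
    Sectional τ F P P → Lead (-k) c F →
    ∃ a : ℕ → ℂ, (∀ z ∈ domain τ, F z = ellipticPoly τ ((Finset.range (k + 1)).erase 1) a z) ∧
      (k ≠ 1 → a k = c) := by
  induction k using Nat.strong_induction_on with
  | _ k ih =>
  intro F P c hF h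
  match k with
  | 0 =>
    refine ⟨fun _ => c, fun z hz => ?_, fun _ => rfl⟩
    rw [h.exists_const hF z hz]
    simp [ellipticPoly, E_zero]
  | 1 =>
    -- A single simple pole is impossible: without a jump, the residue is zero.
    have h0 := hF.integral_jump h.tendsto_mul
    simp only [sub_self, intervalIntegral.integral_zero] at h0
    have hc : c = 0 := (mul_eq_zero.1 h0.symm).resolve_left Complex.two_pi_I_ne_zero
    rw [hc] at h
    obtain ⟨d, hd⟩ := h.succ
    refine ⟨fun _ => d, fun z hz => ?_, fun h => absurd rfl h⟩
    rw [Lead.exists_const hF (by simpa using hd) z hz]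
    have : (Finset.range (1 + 1)).erase 1 = {0} := rfl
    simp [ellipticPoly, E_zero, this]
  | k + 2 =>
    -- Subtracting `c * E (k + 2)` removes the leading term and leaves a pole of order at most `k +
    -- 1`.
    have h1 := h.sub ((lead_E (τ := τ) (j := k + 2) (by omega)).const_mul c)
    rw [mul_one, sub_self] at h1
    obtain ⟨d, hd⟩ := h1.succ
    obtain ⟨a, ha, -⟩ := ih (k + 1) (by omega) (hF.sub ((sectional_E (k + 2)).const_mul c))
      (c := d) (by convert hd using 1; push_cast; ring)
    refine ⟨Function.update a (k + 2) c, fun z hz => ?_, fun _ => by simp⟩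
    have hs : (Finset.range (k + 2 + 1)).erase 1 =
        insert (k + 2) ((Finset.range (k + 1 + 1)).erase 1) := by
      ext j; simp; omega
    rw [ellipticPoly, hs, Finset.sum_insert (by simp), Function.update_self,
      ← sub_eq_iff_eq_add', ha z hz, ellipticPoly]
    refine Finset.sum_congr rfl fun j hj => ?_
    rw [Function.update_of_ne]
    simp at hj
    omega

/-! ### Moments -/

/-- The degrees `{0, 2, 3, …, n - 1}`. -/
abbrev degrees (n : ℕ) : Finset ℕ := (Finset.range n).erase 1

lemma mem_degrees {j n : ℕ} : j ∈ degrees n ↔ j ≠ 1 ∧ j < n := by simp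

lemma degrees_succ {n : ℕ} (hn : n ≠ 1) : degrees (n + 1) = insert n (degrees n) := by
  ext j; simp; omega

lemma sum_degrees_succ {n : ℕ} (hn : n ≠ 1) (f : ℕ → ℂ) :
    ∑ j ∈ degrees (n + 1), f j = f n + ∑ j ∈ degrees n, f j := by
  rw [degrees_succ hn, Finset.sum_insert (by simp)]

lemma sum_degrees_succ_mul {n : ℕ} (hn : n ≠ 1) (b : ℕ → ℂ) {x : ℕ → ℂ}
    (hx : ∀ i ∈ degrees n, x i = 0) : ∑ i ∈ degrees (n + 1), b i * x i = b n * x n := by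
  rw [sum_degrees_succ hn, Finset.sum_eq_zero fun i hi => by rw [hx i hi, mul_zero], add_zero]

lemma moment_comm (i j : ℕ) : moment τ i j = moment τ j i := by
  simp only [moment, mul_comm]

lemma continuous_E_γ (j : ℕ) : Continuous fun t : ℝ => E τ j (γ τ t) :=
  continuous_iff_continuousAt.2 fun t =>
    (analyticAt_E j (γ_notMem_Λ t)).continuousAt.comp continuous_γ.continuousAt

lemma integral_ellipticPoly_mul_E (S : Finset ℕ) (a : ℕ → ℂ) (i : ℕ) :
    ∫ t in (0 : ℝ)..1, ellipticPoly τ S a (γ τ t) * E τ i (γ τ t) =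
      ∑ j ∈ S, a j * moment τ i j := by
  have hE := continuous_E_γ (τ := τ)
  simp only [ellipticPoly, Finset.sum_mul]
  rw [intervalIntegral.integral_finsetSum]
  · refine Finset.sum_congr rfl fun j _ => ?_
    rw [moment_comm, moment, integralγ, ← intervalIntegral.integral_const_mul]
    simp only [mul_assoc]
  · intro j _
    exact (((hE j).const_mul (a j)).mul (hE i)).intervalIntegrable _ _

lemma integral_ellipticPoly_mul (S T : Finset ℕ) (a b : ℕ → ℂ) :
    ∫ t in (0 : ℝ)..1, ellipticPoly τ S a (γ τ t) * ellipticPoly τ T b (γ τ t) =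
      ∑ i ∈ T, b i * ∑ j ∈ S, a j * moment τ i j := by
  have hE := continuous_E_γ (τ := τ)
  have hS : Continuous fun t : ℝ => ellipticPoly τ S a (γ τ t) :=
    continuous_finsetSum _ fun j _ => (hE j).const_mul (a j)
  simp_rw [← integral_ellipticPoly_mul_E, ← intervalIntegral.integral_const_mul]
  rw [← intervalIntegral.integral_finsetSum]
  · refine intervalIntegral.integral_congr fun t _ => ?_
    rw [ellipticPoly.eq_def τ T, Finset.mul_sum]
    refine Finset.sum_congr rfl fun j _ => ?_
    ring
  · intro j _
    exact ((hS.mul (hE j)).const_mul (b j)).intervalIntegrable _ _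

lemma sum_mul_sum_moment (S : Finset ℕ) (a b : ℕ → ℂ) :
    ∑ i ∈ S, b i * ∑ j ∈ S, a j * moment τ i j = ∑ i ∈ S, a i * ∑ j ∈ S, b j * moment τ i j := by
  simp_rw [Finset.mul_sum]
  rw [Finset.sum_comm]
  refine Finset.sum_congr rfl fun i _ => Finset.sum_congr rfl fun j _ => ?_
  rw [moment_comm]
  ring

lemma coeff_eq_zero {n : ℕ} (hD : D τ n ≠ 0) {a : ℕ → ℂ}
    (h : ∀ i ∈ degrees n, ∑ j ∈ degrees n, a j * moment τ i j = 0) : ∀ j ∈ degrees n, a j = 0 := by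
  have := Matrix.eq_zero_of_mulVec_eq_zero hD (v := fun j : Idx n => a j) (by
    funext i
    rw [Pi.zero_apply, ← h i i.2, ← Finset.sum_coe_sort]
    simp only [Matrix.mulVec, dotProduct, Matrix.of_apply, mul_comm])
  exact fun j hj => congrFun this ⟨j, hj⟩

lemma exists_coeff_of_det_eq_zero {n : ℕ} (hD : D τ n = 0) :
    ∃ a : ℕ → ℂ, (∃ j ∈ degrees n, a j ≠ 0) ∧
      ∀ i ∈ degrees n, ∑ j ∈ degrees n, a j * moment τ i j = 0 := by
  obtain ⟨v, hv, h⟩ := Matrix.exists_mulVec_eq_zero_iff.2 hD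
  obtain ⟨j, hj⟩ := Function.ne_iff.1 hv
  let a : ℕ → ℂ := fun i => if hi : i ∈ degrees n then v ⟨i, hi⟩ else 0
  have ha : ∀ i : Idx n, a i = v i := fun i => dif_pos i.2
  refine ⟨a, ⟨j, j.2, by rwa [ha]⟩, fun i hi => ?_⟩
  have := congrFun h ⟨i, hi⟩
  rw [Pi.zero_apply] at this
  rw [← this, ← Finset.sum_coe_sort]
  simp only [Matrix.mulVec, dotProduct, Matrix.of_apply, ha, mul_comm]

/-- Expand along the last row; the cofactors do not depend on that row. With the last unit vector in
it, the determinant is `D_n`, which gives monicity; with a row of moments, two rows coincide, which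
gives orthogonality. -/
lemma exists_eop_coeff {n : ℕ} (hn : n ≠ 1) (hD : D τ n ≠ 0) :
    ∃ e : ℕ → ℂ, e n = 1 ∧ (∀ z, eop τ n z = ellipticPoly τ (degrees (n + 1)) e z) ∧
      ∀ i ∈ degrees n, ∑ j ∈ degrees (n + 1), e j * moment τ i j = 0 := by
  have hmem : n ∈ degrees (n + 1) := by simp [hn]
  let l : Idx (n + 1) := ⟨n, hmem⟩
  let A : (ℕ → ℂ) → Matrix (Idx (n + 1)) (Idx (n + 1)) ℂ := fun f =>
    Matrix.of fun i j => if (i : ℕ) = n then f j else moment τ i j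
  have hadj : ∀ f g j, (A f).adjugate j l = (A g).adjugate j l := by
    intro f g j
    rw [Matrix.adjugate_apply, Matrix.adjugate_apply]
    congr 1
    ext i k
    by_cases hi : i = l
    · subst hi; simp
    · have : (i : ℕ) ≠ n := fun h => hi (Subtype.ext h)
      simp [A, Matrix.updateRow_ne hi, this]
  let c : ℕ → ℂ := fun j =>
    if hj : j ∈ degrees (n + 1) then (A fun _ => 0).adjugate ⟨j, hj⟩ l else 0
  have hc : ∀ j : Idx (n + 1), c j = (A fun _ => 0).adjugate j l := fun j => dif_pos j.2
  have hdet : ∀ f : ℕ → ℂ, (A f).det = ∑ j ∈ degrees (n + 1), c j * f j := by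
    intro f
    rw [Matrix.det_eq_sum_mul_adjugate_row _ l,
      ← Finset.sum_coe_sort (degrees (n + 1)) fun j => c j * f j]
    refine Finset.sum_congr rfl fun j _ => ?_
    rw [hadj f (fun _ => 0), ← hc, mul_comm]
    simp [A, l]
  have hcn : c n = D τ n := by
    let f : ℕ → ℂ := fun j => if j = n then 1 else 0
    have h1 : c n = (A f).det := by
      rw [hdet f, Finset.sum_eq_single n]
      · simp [f]
      · intro j _ hj; simp [f, hj]
      · intro h; exact absurd hmem h
    rw [h1, Matrix.twoBlockTriangular_det' _ (fun i : Idx (n + 1) => (i : ℕ) = n)]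
    · have h2 : Matrix.toSquareBlockProp (A f) (fun i : Idx (n + 1) => (i : ℕ) = n) = 1 := by
        ext i j
        have : i = j := Subtype.ext (Subtype.ext (i.2.trans j.2.symm))
        subst this
        have := i.2
        simp [Matrix.toSquareBlockProp, A, f, this]
      rw [h2, Matrix.det_one, one_mul, D]
      let e : Idx n ≃ {i : Idx (n + 1) // ¬ (i : ℕ) = n} :=
        { toFun := fun i => ⟨⟨i, by have := mem_degrees.1 i.2; exact mem_degrees.2 (by omega)⟩,
            (mem_degrees.1 i.2).2.ne⟩
          invFun := fun i => ⟨i, by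
            have := mem_degrees.1 i.1.2
            have := i.2
            exact mem_degrees.2 (by omega)⟩
          left_inv := fun i => rfl
          right_inv := fun i => rfl }
      rw [← Matrix.det_submatrix_equiv_self e]
      congr 1
      ext i j
      have : (i : ℕ) ≠ n := (mem_degrees.1 i.2).2.ne
      simp [Matrix.toSquareBlockProp, A, e, this]
    · intro i hi j hj
      simp [A, f, hi, hj]
  refine ⟨fun j => (D τ n)⁻¹ * c j, by simp [hcn, hD], fun z => ?_, fun i hi => ?_⟩
  · have := hdet fun j => E τ j z
    simp only [A] at this
    simp only [eop, this, ellipticPoly, Finset.mul_sum, mul_assoc]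
  · have h0 : (A fun j => moment τ i j).det = 0 := by
      have hi' : i ∈ degrees (n + 1) := by simp at hi ⊢; omega
      refine Matrix.det_zero_of_row_eq (i := l) (j := ⟨i, hi'⟩) ?_ ?_
      · intro h
        have : n = i := congrArg Subtype.val h
        simp [← this] at hi
      · funext j
        have : i ≠ n := by simp at hi; omega
        simp [A, l, this]
    simp only [mul_assoc]
    rw [← Finset.mul_sum, ← hdet, h0, mul_zero]

lemma h_eq {n : ℕ} (hn : n ≠ 1) {e : ℕ → ℂ} (he : e n = 1)
    (h1 : ∀ z, eop τ n z = ellipticPoly τ (degrees (n + 1)) e z)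
    (h2 : ∀ i ∈ degrees n, ∑ j ∈ degrees (n + 1), e j * moment τ i j = 0) :
    h τ n = ∑ j ∈ degrees (n + 1), e j * moment τ n j := by
  rw [h, integralγ]
  simp_rw [h1, sq]
  rw [integral_ellipticPoly_mul, sum_degrees_succ_mul hn e h2, he, one_mul]

/-- The leading coefficient of the elliptic polynomial of degree `n` dual to `E_n`. -/
lemma dual_leading_coeff {n : ℕ} (hn : n ≠ 1) (hD : D τ (n + 1) ≠ 0) {a : ℕ → ℂ} {c : ℂ}
    (h0 : ∀ i ∈ degrees n, ∑ j ∈ degrees (n + 1), a j * moment τ i j = 0)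
    (h1 : ∑ j ∈ degrees (n + 1), a j * moment τ n j = c) :
    (D τ n ≠ 0 → a n * h τ n = c) ∧ (D τ n = 0 → a n = 0) := by
  -- The symmetric moment pairing of `a` with `b` is evaluated in both orders; orthogonality leaves
  -- only the index `n`.
  have key : ∀ b : ℕ → ℂ, (∀ i ∈ degrees n, ∑ j ∈ degrees (n + 1), b j * moment τ i j = 0) →
      b n * c = a n * ∑ j ∈ degrees (n + 1), b j * moment τ n j := by
    intro b hb
    have := sum_mul_sum_moment (τ := τ) (degrees (n + 1)) a b
    rwa [sum_degrees_succ_mul hn b h0, h1, sum_degrees_succ_mul hn a hb] at this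
  constructor
  · intro hDn
    obtain ⟨e, e1, e2, e3⟩ := exists_eop_coeff hn hDn
    rw [h_eq hn e1 e2 e3, ← key e e3, e1, one_mul]
  · intro hDn
    by_contra ha
    -- A kernel vector for `D_n`, extended by zero at `n`, would by `key` be orthogonal to `E_n` as
    -- well if `a n ≠ 0`. It would lie in the kernel for `D_{n+1}`.
    obtain ⟨p, ⟨k, hk, hpk⟩, hp⟩ := exists_coeff_of_det_eq_zero hDn
    set b : ℕ → ℂ := Function.update p n 0 with hb
    have hbp : ∀ j ∈ degrees n, b j = p j := fun j hj => by
      rw [hb, Function.update_of_ne]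
      simp at hj
      omega
    have hsum : ∀ i ∈ degrees n, ∑ j ∈ degrees (n + 1), b j * moment τ i j = 0 := by
      intro i hi
      rw [sum_degrees_succ hn, ← hp i hi, hb, Function.update_self, zero_mul, zero_add]
      exact Finset.sum_congr rfl fun j hj => by rw [← hb, hbp j hj]
    have h2 := key b hsum
    rw [hb, Function.update_self, zero_mul, ← hb] at h2
    have h3 := (mul_eq_zero.1 h2.symm).resolve_left ha
    have h4 := coeff_eq_zero hD (a := b) (by
      intro i hi
      rw [degrees_succ hn, Finset.mem_insert] at hi
      rcases hi with rfl | hi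
      · exact h3
      · exact hsum i hi) k (by rw [degrees_succ hn]; exact Finset.mem_insert_of_mem hk)
    exact hpk (by rw [← hbp k hk, h4])

/-! ### Rows of the Riemann-Hilbert problem -/

/-- A row `(u, v)` satisfying the jump condition: `u` has limits `P` on the contour, and `v` has
limits `Q` from above and `M` from below. -/
structure Row (τ : UpperHalfPlane) (u v : ℂ → ℂ) (P Q M : ℝ → ℂ) : Prop where
  fst : Sectional τ u P P
  snd : Sectional τ v Q M
  jump : ∀ t, Q t = M t + P t

variable {u v u' v' w : ℂ → ℂ} {Q Q' W : ℝ → ℂ}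

lemma Row.sub (h : Row τ u v P Q M) (h' : Row τ u' v' P' Q' M') :
    Row τ (fun z => u z - u' z) (fun z => v z - v' z) (fun t => P t - P' t)
      (fun t => Q t - Q' t) (fun t => M t - M' t) :=
  ⟨h.fst.sub h'.fst, h.snd.sub h'.snd, fun t => by rw [h.jump, h'.jump]; ring⟩

lemma Row.const_mul (h : Row τ u v P Q M) (c : ℂ) :
    Row τ (fun z => c * u z) (fun z => c * v z) (fun t => c * P t)
      (fun t => c * Q t) (fun t => c * M t) :=
  ⟨h.fst.const_mul c, h.snd.const_mul c, fun t => by rw [h.jump]; ring⟩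

/-- Reflection swaps the sides of the contour; the sign on the second entry restores the jump
relation. -/
lemma Row.comp_neg (h : Row τ u v P Q M) :
    Row τ (fun z => u (-z)) (fun z => -1 * v (-z)) (fun t => P (-t))
      (fun t => -1 * M (-t)) (fun t => -1 * Q (-t)) :=
  ⟨h.fst.comp_neg, h.snd.comp_neg.const_mul (-1), fun t => by rw [h.jump]; ring⟩

/-- The jump of `v * w` is `P * W`, so the residue theorem applies. -/
lemma Row.integral_mul (h : Row τ u v P Q M) (hw : Sectional τ w W W) {c : ℂ}
    (hc : Lead (-1) c fun z => v z * w z) :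
    ∫ t in (0 : ℝ)..1, P t * W t = 2 * Real.pi * Complex.I * c := by
  rw [← (h.snd.mul hw).integral_jump hc.tendsto_mul]
  congr 1
  funext t
  rw [h.jump]
  ring

lemma Row.sum_eq {m : ℕ} (h : Row τ u v P Q M) {a : ℕ → ℂ}
    (ha : ∀ z ∈ domain τ, u z = ellipticPoly τ (degrees m) a z) (i : ℕ) {c : ℂ}
    (hc : Lead (-1) c fun z => v z * E τ i z) :
    ∑ j ∈ degrees m, a j * moment τ i j = 2 * Real.pi * Complex.I * c := by
  rw [← h.integral_mul (sectional_E i) hc, ← integral_ellipticPoly_mul_E,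
    (h.fst.limits_unique (sectional_ellipticPoly _ _) ha).1]

/-- The moment determinant being nonzero, the homogeneous problem has only the zero solution. -/
theorem Row.eq_zero {m : ℕ} (hm : 1 ≤ m) (hD : D τ (m + 1) ≠ 0) (h : Row τ u v P Q M) {c d : ℂ}
    (hu : Lead (-m) c u) (hv : Lead m d v) : ∀ z ∈ domain τ, u z = 0 ∧ v z = 0 := by
  obtain ⟨a, ha, -⟩ := h.fst.exists_ellipticPoly m hu
  -- For `i ≤ m` the product `v * E_i` is regular at 0: every moment of `u` vanishes.
  have h0 := coeff_eq_zero hD (a := a) (by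
    intro i hi
    rw [Finset.mem_erase, Finset.mem_range] at hi
    rw [h.sum_eq ha i (c := 0), mul_zero]
    exact (hv.mul (lead_E hi.1)).of_lt (by omega))
  have hu0 : ∀ z ∈ domain τ, u z = 0 := fun z hz => by
    rw [ha z hz, ellipticPoly]
    exact Finset.sum_eq_zero fun j hj => by rw [h0 j hj, zero_mul]
  have hP : P = fun _ => 0 := by
    have hz : Sectional τ (fun _ => 0) (fun _ => 0) (fun _ => 0) :=
      .of_analytic (f := fun _ => 0) (by simp) fun _ _ => analyticAt_const
    exact (h.fst.limits_unique hz hu0).1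
  have hQ : Q = M := by
    funext t
    rw [h.jump, hP, add_zero]
  have hs := h.snd
  rw [hQ] at hs
  exact fun z hz => ⟨hu0 z hz, (hv.of_lt (l := 0) (by omega)).exists_const hs z hz⟩

variable {Y : ℂ → Matrix (Fin 2) (Fin 2) ℂ}

/-! ### Solutions of the Riemann-Hilbert problem -/

/-- Periodicity under integer translations extends the limits from `[0, 1]` to all real parameters
by fractional parts. -/
lemma IsRHPSolution.exists_limits {n : ℕ} (hY : IsRHPSolution τ n Y) :
    ∃ P M : ℝ → Matrix (Fin 2) (Fin 2) ℂ,
      (∀ i j, Sectional τ (fun z => Y z i j) (fun t => P t i j) (fun t => M t i j)) ∧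
      ∀ t, P t = M t * !![1, 1; 0, 1] := by
  have hfr : ∀ t : ℝ, Int.fract t ∈ Set.Icc (0 : ℝ) 1 :=
    fun t => ⟨Int.fract_nonneg t, (Int.fract_lt_one t).le⟩
  choose P M hP hM hj using fun t : ℝ => hY.jump (Int.fract t) (hfr t)
  have hγ : ∀ t : ℝ, γ τ t + ((-⌊t⌋ : ℤ) : ℂ) = γ τ (Int.fract t) := fun t => by
    rw [← γ_add_int, Int.cast_neg, ← sub_eq_add_neg, Int.self_sub_floor]
  have hcont : ∀ t : ℝ, Tendsto (fun z : ℂ => z + ((-⌊t⌋ : ℤ) : ℂ)) (𝓝 (γ τ t))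
      (𝓝 (γ τ (Int.fract t))) := fun t => by
    have : ContinuousAt (fun z : ℂ => z + ((-⌊t⌋ : ℤ) : ℂ)) (γ τ t) := by fun_prop
    rw [ContinuousAt, hγ] at this
    exact this
  have entry : ∀ {l : Filter ℂ} {A : Matrix (Fin 2) (Fin 2) ℂ}, Tendsto Y l (𝓝 A) →
      ∀ i j, Tendsto (fun z => Y z i j) l (𝓝 (A i j)) := fun h i j =>
    ((continuous_id.matrix_elem i j).tendsto _).comp h
  refine ⟨P, M, fun i j => ⟨fun z hz l hl => ?_, hY.analytic i j, fun t => ?_, fun t => ?_⟩, hj⟩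
  · rw [hY.periodic z hz l hl]
  · have h1 : Tendsto (fun z : ℂ => z + ((-⌊t⌋ : ℤ) : ℂ)) (𝓝[{z | (γ τ t).im < z.im}] (γ τ t))
        (𝓝[{z | (γ τ (Int.fract t)).im < z.im}] (γ τ (Int.fract t))) := by
      refine tendsto_nhdsWithin_iff.2 ⟨(hcont t).mono_left nhdsWithin_le_nhds, ?_⟩
      filter_upwards [self_mem_nhdsWithin] with z hz
      simpa using hz
    refine ((entry (hP t) i j).comp h1).congr' ?_
    filter_upwards [eventually_mem_domain_above t] with z hz
    simp only [Function.comp_apply, hY.periodic z hz _ (intCast_mem_Λ _)]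
  · have h1 : Tendsto (fun z : ℂ => z + ((-⌊t⌋ : ℤ) : ℂ)) (𝓝[{z | z.im < (γ τ t).im}] (γ τ t))
        (𝓝[{z | z.im < (γ τ (Int.fract t)).im}] (γ τ (Int.fract t))) := by
      refine tendsto_nhdsWithin_iff.2 ⟨(hcont t).mono_left nhdsWithin_le_nhds, ?_⟩
      filter_upwards [self_mem_nhdsWithin] with z hz
      simpa using hz
    refine ((entry (hM t) i j).comp h1).congr' ?_
    filter_upwards [eventually_mem_domain_below t] with z hz
    simp only [Function.comp_apply, hY.periodic z hz _ (intCast_mem_Λ _)]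

/-- The rows of a solution of index `k + 1`, with their leading behaviour at the origin. -/
structure RowData (τ : UpperHalfPlane) (k : ℕ) (Y : ℂ → Matrix (Fin 2) (Fin 2) ℂ)
    (P Q M P' Q' M' : ℝ → ℂ) (a b : ℂ) : Prop where
  row₁ : Row τ (fun z => Y z 0 0) (fun z => Y z 0 1) P Q M
  row₂ : Row τ (fun z => Y z 1 0) (fun z => Y z 1 1) P' Q' M'
  lead₁₁ : Lead (-(k + 1)) 1 fun z => Y z 0 0
  lead₁₂ : Lead k b fun z => Y z 0 1
  lead₂₁ : Lead (-k) a fun z => Y z 1 0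
  lead₂₂ : Lead (k - 1) 1 fun z => Y z 1 1

lemma IsRHPSolution.exists_rowData {k : ℕ} (hY : IsRHPSolution τ (k + 1) Y) :
    ∃ P Q M P' Q' M' a b, RowData τ k Y P Q M P' Q' M' a b := by
  obtain ⟨P, M, hs, hj⟩ := hY.exists_limits
  have h0 : ∀ i, (fun t => M t i 0) = fun t => P t i 0 := fun i => by
    funext t
    simp [hj, Matrix.mul_apply, Fin.sum_univ_two]
  have h1 : ∀ i t, P t i 1 = M t i 1 + P t i 0 := fun i t => by
    simp [hj, Matrix.mul_apply, Fin.sum_univ_two]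
    ring
  have hd : ∀ i j, ∀ᶠ z in 𝓝[≠] (0 : ℂ), DifferentiableAt ℂ (fun z => Y z i j) z := fun i j =>
    eventually_mem_domain.mono fun z hz => (hY.analytic i j z hz).differentiableAt
  have hr : ∀ i, Row τ (fun z => Y z i 0) (fun z => Y z i 1) (fun t => P t i 0)
      (fun t => P t i 1) (fun t => M t i 1) := fun i =>
    ⟨by simpa only [h0] using hs i 0, hs i 1, h1 i⟩
  have l00 : Lead (-(k + 1)) 1 fun z => Y z 0 0 := by
    refine lead_of_bounded (hd 0 0) ?_
    simpa [Matrix.mul_diagonal, mul_comm] using hY.asymp 0 0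
  have l01 : Lead (k - 1) 0 fun z => Y z 0 1 := by
    refine lead_of_bounded (hd 0 1) ?_
    have e : (2 - (k + 1) : ℤ) = 1 - k := by ring
    simpa [Matrix.mul_diagonal, mul_comm, e] using hY.asymp 0 1
  have l10 : Lead (-(k + 1)) 0 fun z => Y z 1 0 := by
    refine lead_of_bounded (hd 1 0) ?_
    simpa [Matrix.mul_diagonal, mul_comm] using hY.asymp 1 0
  have l11 : Lead (k - 1) 1 fun z => Y z 1 1 := by
    refine lead_of_bounded (hd 1 1) ?_
    have e : (2 - (k + 1) : ℤ) = 1 - k := by ring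
    simpa [Matrix.mul_diagonal, mul_comm, e] using hY.asymp 1 1
  -- The off-diagonal entries of the normalised matrix are `O(z)`, which gains one order.
  obtain ⟨b, hb⟩ := l01.succ
  obtain ⟨a, ha⟩ := l10.succ
  rw [sub_add_cancel] at hb
  rw [neg_add_rev, neg_add_cancel_comm] at ha
  exact ⟨_, _, _, _, _, _, a, b, hr 0, hr 1, l00, hb, ha, l11⟩

variable {k : ℕ} {a b : ℂ}

lemma neg_one_zpow_neg_succ (k : ℕ) : (-1 : ℂ) ^ (-(k + 1) : ℤ) = (-1) ^ (k + 1) := by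
  rw [show (-(k + 1) : ℤ) = -((k + 1 : ℕ) : ℤ) by push_cast; ring, zpow_neg, zpow_natCast,
    ← inv_pow, inv_neg, inv_one]

lemma neg_one_pow_mul_self (k : ℕ) : (-1 : ℂ) ^ k * (-1) ^ k = 1 := by
  rw [← mul_pow]
  simp

/-- The row minus its signed reflection is again a row. The leading terms of its first entry cancel,
lowering the pole order to `k`, and `Row.eq_zero` applies. -/
lemma RowData.parity₁ (hk : 1 ≤ k) (hD : D τ (k + 1) ≠ 0) (h : RowData τ k Y P Q M P' Q' M' a b) :
    ∀ z ∈ domain τ, Y z 0 0 = (-1) ^ (k + 1) * Y (-z) 0 0 ∧ Y z 0 1 = (-1) ^ k * Y (-z) 0 1 := by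
  intro z hz
  obtain ⟨s, hs⟩ : ∃ s : ℂ, s = (-1) ^ (k + 1) := ⟨_, rfl⟩
  have e : s * ((-1) ^ (-(k + 1) : ℤ) * 1) = 1 := by
    rw [hs, neg_one_zpow_neg_succ, mul_one, neg_one_pow_mul_self]
  have h1 := h.lead₁₁.sub (h.lead₁₁.comp_neg.const_mul s)
  rw [e, sub_self] at h1
  obtain ⟨d, h1⟩ := h1.succ
  rw [neg_add_rev, neg_add_cancel_comm] at h1
  have h2 := h.lead₁₂.sub ((h.lead₁₂.comp_neg.const_mul (-1)).const_mul s)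
  have h3 := (h.row₁.sub (h.row₁.comp_neg.const_mul s)).eq_zero hk hD h1 h2 z hz
  rw [← hs]
  refine ⟨sub_eq_zero.1 h3.1, ?_⟩
  rw [sub_eq_zero.1 h3.2, hs]
  ring

/-- Here it is the second entry of the difference whose leading terms cancel, so that it vanishes to
order `k`. -/
lemma RowData.parity₂ (hk : 1 ≤ k) (hD : D τ (k + 1) ≠ 0) (h : RowData τ k Y P Q M P' Q' M' a b) :
    ∀ z ∈ domain τ, Y z 1 0 = (-1) ^ k * Y (-z) 1 0 ∧ Y z 1 1 = (-1) ^ (k + 1) * Y (-z) 1 1 := by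
  intro z hz
  have h1 := h.lead₂₁.sub (h.lead₂₁.comp_neg.const_mul ((-1) ^ k))
  have h2 := h.lead₂₂.sub ((h.lead₂₂.comp_neg.const_mul (-1)).const_mul ((-1) ^ k))
  have e : (-1 : ℂ) ^ k * (-1 * ((-1) ^ (k - 1 : ℤ) * 1)) = 1 := by
    rw [zpow_sub_one₀ (by norm_num), zpow_natCast]
    have := neg_one_pow_mul_self k
    simp only [inv_neg, inv_one]
    linear_combination this
  rw [e, sub_self] at h2
  obtain ⟨d, h2⟩ := h2.succ
  rw [sub_add_cancel] at h2
  have h3 := (h.row₂.sub (h.row₂.comp_neg.const_mul ((-1) ^ k))).eq_zero hk hD h1 h2 z hz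
  refine ⟨sub_eq_zero.1 h3.1, ?_⟩
  rw [sub_eq_zero.1 h3.2]
  ring

/-- The `(1,1)` entry is monic of degree `k + 1` and orthogonal to lower degrees, so `D_{k+1} ≠ 0`
identifies it with `π_{k+1}`. Its moment against `E_{k+1}` is `2πi` times the residue `b`. -/
lemma RowData.h_eq (hk : 1 ≤ k) (hD : D τ (k + 1) ≠ 0) (h : RowData τ k Y P Q M P' Q' M' a b) :
    EllipticOP.h τ (k + 1) = 2 * Real.pi * Complex.I * b := by
  have hk1 : k + 1 ≠ 1 := by omega
  obtain ⟨x, hx, hx1⟩ := h.row₁.fst.exists_ellipticPoly (k + 1) (c := 1)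
    (by exact_mod_cast h.lead₁₁)
  have hx1 := hx1 hk1
  obtain ⟨e, e1, e2, e3⟩ := exists_eop_coeff hk1 hD
  have hx0 : ∀ i ∈ degrees (k + 1), ∑ j ∈ degrees (k + 1 + 1), x j * moment τ i j = 0 := by
    intro i hi
    rw [mem_degrees] at hi
    rw [h.row₁.sum_eq hx i (c := 0), mul_zero]
    exact (h.lead₁₂.mul (lead_E hi.1)).of_lt (by omega)
  have hd := coeff_eq_zero hD (a := fun j => x j - e j) (by
    intro i hi
    have h1 := hx0 i hi
    have h2 := e3 i hi
    rw [sum_degrees_succ hk1, hx1] at h1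
    rw [sum_degrees_succ hk1, e1] at h2
    simp_rw [sub_mul]
    rw [Finset.sum_sub_distrib]
    linear_combination h1 - h2)
  have hxe : ∀ j ∈ degrees (k + 1 + 1), e j = x j := by
    intro j hj
    rw [degrees_succ hk1, Finset.mem_insert] at hj
    rcases hj with rfl | hj
    · rw [hx1, e1]
    · exact (sub_eq_zero.1 (hd j hj)).symm
  have hlead := h.lead₁₂.mul (lead_E (τ := τ) hk1)
  rw [EllipticOP.h_eq hk1 e1 e2 e3, Finset.sum_congr rfl fun j hj => by rw [hxe j hj],
    h.row₁.sum_eq hx (k + 1) (c := b) (by convert hlead using 1 <;> push_cast <;> ring)]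

/-- If `b` were zero, the first row would solve a homogeneous problem, contradicting its leading
coefficient one. -/
lemma RowData.b_ne_zero (hD : D τ (k + 1 + 1) ≠ 0) (h : RowData τ k Y P Q M P' Q' M' a b) :
    b ≠ 0 := by
  rintro rfl
  obtain ⟨d, hd⟩ := h.lead₁₂.succ
  have h0 := h.row₁.eq_zero (m := k + 1) (by omega) hD (c := 1) (d := d)
    (by exact_mod_cast h.lead₁₁) (by exact_mod_cast hd)
  have h1 : Lead (-(k + 1)) 0 fun z => Y z 0 0 :=
    ⟨fun _ => 0, analyticAt_const, rfl,
      eventually_mem_domain.mono fun z hz => by simpa using (h0 z hz).1⟩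
  exact one_ne_zero (h.lead₁₁.unique h1)

/-- The `(2,1)` entry is orthogonal to degrees below `k` and has moment `2πi` against `E_k`. Duality
gives `a = 2πi / h_k`, or `a = 0` if `D_k = 0`, while `b = h_{k+1} / (2πi)`. -/
lemma RowData.mul_eq (hk : 2 ≤ k) (hD : D τ (k + 1) ≠ 0) (h : RowData τ k Y P Q M P' Q' M' a b) :
    b * a = if D τ k = 0 then 0 else EllipticOP.h τ (k + 1) / EllipticOP.h τ k := by
  have hk1 : k ≠ 1 := by omega
  obtain ⟨x, hx, hx1⟩ := h.row₂.fst.exists_ellipticPoly k h.lead₂₁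
  have hx1 := hx1 hk1
  have hx0 : ∀ i ∈ degrees k, ∑ j ∈ degrees (k + 1), x j * moment τ i j = 0 := by
    intro i hi
    rw [mem_degrees] at hi
    rw [h.row₂.sum_eq hx i (c := 0), mul_zero]
    exact (h.lead₂₂.mul (lead_E hi.1)).of_lt (by omega)
  have hlead := h.lead₂₂.mul (lead_E (τ := τ) hk1)
  have hxk := h.row₂.sum_eq hx k (c := 1) (by convert hlead using 1 <;> ring)
  obtain ⟨g1, g2⟩ := dual_leading_coeff hk1 hD hx0 hxk
  rw [hx1] at g1 g2
  split_ifs with h0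
  · rw [g2 h0, mul_zero]
  · have g1 := g1 h0
    rw [mul_one] at g1
    have hh : EllipticOP.h τ k ≠ 0 := fun hh => by
      rw [hh, mul_zero] at g1
      exact Complex.two_pi_I_ne_zero g1.symm
    rw [h.h_eq (by omega) hD, eq_div_iff hh]
    linear_combination b * g1

/-- The expression is the determinant of two rows with the same jump matrix, which has determinant
one. Its limits from both sides agree. -/
lemma RowData.sectional_mul_sub {k' : ℕ} {Y' : ℂ → Matrix (Fin 2) (Fin 2) ℂ}
    {R S T R' S' T' : ℝ → ℂ} {a' b' : ℂ} (h : RowData τ k Y P Q M P' Q' M' a b)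
    (h' : RowData τ k' Y' R S T R' S' T' a' b') :
    ∃ W, Sectional τ (fun z => Y' z 0 0 * Y z 1 1 - Y' z 0 1 * Y z 1 0) W W := by
  have h1 := (h'.row₁.fst.mul h.row₂.snd).sub (h'.row₁.snd.mul h.row₂.fst)
  refine ⟨fun t => R t * Q' t - S t * P' t, ?_⟩
  convert h1 using 1
  funext t
  rw [h'.row₁.jump, h.row₂.jump]
  ring

/-- By parity the diagonal product is `z⁻² + c + c̃ + o(1)`, and the off-diagonal product tends to
`b * a`. Subtracting `℘` leaves a regular function without jump, hence a constant. -/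
lemma RowData.det_eq (hk : 2 ≤ k) (hD : D τ (k + 1) ≠ 0) (h : RowData τ k Y P Q M P' Q' M' a b) :
    ∃ α, IsAlpha τ (k + 1) Y α ∧ ∀ z ∈ domain τ, (Y z).det = wp τ z + α := by
  have hp₁ := h.parity₁ (by omega) hD
  have hp₂ := h.parity₂ (by omega) hD
  have hsq := neg_one_pow_mul_self k
  obtain ⟨u, hu, hu'⟩ := h.lead₁₁.expansion_of_parity (s := (-1) ^ (k + 1))
    (by rw [neg_one_zpow_neg_succ, neg_one_pow_mul_self])
    (eventually_mem_domain.mono fun z hz => (hp₁ z hz).1)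
  obtain ⟨w, hw, hw'⟩ := h.lead₂₂.expansion_of_parity (s := (-1) ^ (k + 1))
    (by
      rw [zpow_sub_one₀ (by norm_num), zpow_natCast, inv_neg, inv_one]
      linear_combination hsq)
    (eventually_mem_domain.mono fun z hz => (hp₂ z hz).2)
  have hlead : Lead 0 (u 0 + w 0) fun z => Y z 0 0 * Y z 1 1 - z ^ (-2 : ℤ) := by
    refine ⟨fun z => u z + w z + z ^ 2 * u z * w z,
      (hu.add hw).add (((analyticAt_id.pow 2).mul hu).mul hw), by simp, ?_⟩
    filter_upwards [hu', hw', eventually_ne_zero] with z h1 h2 h0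
    rw [h1, h2, zpow_zero, one_mul]
    have e : z ^ (-(k + 1) : ℤ) * z ^ (k - 1 : ℤ) = z ^ (-2 : ℤ) := by
      rw [← zpow_add₀ h0]
      congr 1
      ring
    have e2 : z ^ (-2 : ℤ) * z ^ 2 = 1 := by
      rw [zpow_neg, zpow_ofNat]
      exact inv_mul_cancel₀ (pow_ne_zero 2 h0)
    linear_combination (1 + z ^ 2 * u z) * (1 + z ^ 2 * w z) * e +
      (u z + w z + z ^ 2 * u z * w z) * e2
  have hba := h.lead₁₂.mul h.lead₂₁
  rw [add_neg_cancel] at hba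
  have hdet := (hlead.sub hba).sub (lead_wp_sub (τ := τ))
  obtain ⟨W, hW⟩ := h.sectional_mul_sub h
  have hwp := sectional_E (τ := τ) 2
  rw [E_two] at hwp
  have hconst := Lead.exists_const (hW.sub hwp) (c := u 0 + w 0 - b * a - 0)
    (hdet.congr (.of_forall fun z => by ring))
  refine ⟨u 0 + w 0 - b * a, ⟨u 0, w 0, ?_, ?_, ?_⟩, fun z hz => ?_⟩
  · simpa using isBigO_of_expansion hu hu'
  · have := isBigO_of_expansion hw hw'
    have e : (2 - ((k + 1 : ℕ) : ℤ)) = -(k - 1) := by push_cast; ring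
    rw [e]
    exact this
  · rw [h.mul_eq hk hD, Nat.add_sub_cancel]
  · rw [Matrix.det_fin_two]
    linear_combination hconst z hz

/-! ### Comparison of consecutive indices -/

variable {Y' : ℂ → Matrix (Fin 2) (Fin 2) ℂ} {R S T R' S' T' : ℝ → ℂ} {a' b' : ℂ}

/-- Since `b = h_{k+1} / (2πi)`, the chosen factor cancels the leading terms of the second entries,
and the difference of the rows solves the homogeneous problem for `D_{k+2}`. -/
lemma RowData.snd_row_succ (hk : 1 ≤ k) (hD : D τ (k + 1) ≠ 0) (hD' : D τ (k + 1 + 1) ≠ 0)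
    (h : RowData τ k Y P Q M P' Q' M' a b) (h' : RowData τ (k + 1) Y' R S T R' S' T' a' b') :
    ∀ z ∈ domain τ, Y' z 1 0 = 2 * Real.pi * Complex.I / EllipticOP.h τ (k + 1) * Y z 0 0 ∧
      Y' z 1 1 = 2 * Real.pi * Complex.I / EllipticOP.h τ (k + 1) * Y z 0 1 := by
  intro z hz
  have hb := h.b_ne_zero hD'
  set s := 2 * Real.pi * Complex.I / EllipticOP.h τ (k + 1) with hs
  have hsb : s * b = 1 := by
    rw [hs, h.h_eq hk hD]
    have := Complex.two_pi_I_ne_zero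
    field_simp
  have h1 := (show Lead (-(k + 1)) a' fun z => Y' z 1 0 by exact_mod_cast h'.lead₂₁).sub
    (h.lead₁₁.const_mul s)
  have h2 := (show Lead k 1 fun z => Y' z 1 1 by simpa using h'.lead₂₂).sub (h.lead₁₂.const_mul s)
  rw [hsb, sub_self] at h2
  obtain ⟨d, h2⟩ := h2.succ
  have h3 := (h'.row₂.sub (h.row₁.const_mul s)).eq_zero (m := k + 1) (by omega) hD'
    (by exact_mod_cast h1) (by exact_mod_cast h2) z hz
  exact ⟨sub_eq_zero.1 h3.1, sub_eq_zero.1 h3.2⟩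

lemma RowData.mul_sub_eq (hk : 2 ≤ k) (hD : D τ (k + 1) ≠ 0) (hD' : D τ (k + 1 + 1) ≠ 0)
    (h : RowData τ k Y P Q M P' Q' M' a b) (h' : RowData τ (k + 1) Y' R S T R' S' T' a' b') :
    ∀ z ∈ domain τ, Y' z 0 0 * Y z 1 1 - Y' z 0 1 * Y z 1 0 = -(wp' τ z) / 2 := by
  have hsq := neg_one_pow_mul_self k
  have hp₁ := h'.parity₁ (by omega) hD'
  have hp₂ := h.parity₂ (by omega) hD
  obtain ⟨W, hW⟩ := h.sectional_mul_sub h'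
  have l1 := h'.lead₁₁.mul h.lead₂₂
  have l2 := (h'.lead₁₂.mul h.lead₂₁).of_lt (l := -3) (by push_cast; omega)
  have l3 : Lead (-3) 1 fun z => Y' z 0 0 * Y z 1 1 := by
    convert l1 using 1
    · push_cast; ring
    · ring
  have l4 := (l3.sub l2).sub (lead_E (τ := τ) (j := 3) (by norm_num))
  rw [sub_zero, sub_self] at l4
  obtain ⟨d, l4⟩ := l4.succ
  -- After subtraction of `E_3` only a combination of `1` and `℘` remains. It is even while the left
  -- side is odd, so comparing `z` with `-z` removes it.
  obtain ⟨x, hx, -⟩ := (hW.sub (sectional_E 3)).exists_ellipticPoly 2 (by simpa using l4)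
  have hdeg : (Finset.range (2 + 1)).erase 1 = {0, 2} := rfl
  simp only [hdeg, ellipticPoly, Finset.sum_pair (show (0 : ℕ) ≠ 2 by norm_num)] at hx
  intro z hz
  have h1 := hx z hz
  have h2 := hx (-z) (neg_mem_domain hz)
  rw [E_neg, E_neg, E_neg] at h2
  rw [(hp₁ z hz).1, (hp₁ z hz).2, (hp₂ z hz).1, (hp₂ z hz).2] at h1 ⊢
  rw [← E_three]
  have h2' : Y' (-z) 0 0 * Y (-z) 1 1 - Y' (-z) 0 1 * Y (-z) 1 0 + E τ 3 z =
      x 0 * E τ 0 z + x 2 * E τ 2 z := by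
    linear_combination h2
  linear_combination (h1 - h2') / 2 - (Y' (-z) 0 0 * Y (-z) 1 1 - Y' (-z) 0 1 * Y (-z) 1 0) * hsq / 2

end EllipticOP

theorem proposition3p1 (τ : UpperHalfPlane) (n : ℕ) (hn : 3 ≤ n)
    (hD : EllipticOP.D τ n ≠ 0) (hD₁ : EllipticOP.D τ (n + 1) ≠ 0)
    (Y Y₁ : ℂ → Matrix (Fin 2) (Fin 2) ℂ)
    (hY : EllipticOP.IsRHPSolution τ n Y) (hY₁ : EllipticOP.IsRHPSolution τ (n + 1) Y₁) :
    (∀ z ∈ EllipticOP.domain τ, (Y z).det ≠ 0 →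
      Y₁ z = EllipticOP.R τ n (fun w => (Y w).det) (fun w => (Y₁ w).det) z * Y z) ∧
    (∃ α : ℂ, EllipticOP.IsAlpha τ n Y α ∧
      ∀ z ∈ EllipticOP.domain τ, (Y z).det = EllipticOP.wp τ z + α) ∧
    (∃ α₁ : ℂ, EllipticOP.IsAlpha τ (n + 1) Y₁ α₁ ∧
      ∀ z ∈ EllipticOP.domain τ, (Y₁ z).det = EllipticOP.wp τ z + α₁) := by
  obtain ⟨k, rfl⟩ : ∃ k, n = k + 1 := ⟨n - 1, by omega⟩
  obtain ⟨P, Q, M, P', Q', M', a, b, h⟩ := hY.exists_rowData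
  obtain ⟨_, _, _, _, _, _, a', b', h'⟩ := hY₁.exists_rowData
  refine ⟨fun z hz hdet => ?_, h.det_eq (by omega) hD, h'.det_eq (by omega) hD₁⟩
  have hs := h.snd_row_succ (by omega) hD hD₁ h' z hz
  have hg := h.mul_sub_eq (by omega) hD hD₁ h' z hz
  have hpi := Complex.two_pi_I_ne_zero
  have hh : EllipticOP.h τ (k + 1) ≠ 0 := by
    rw [h.h_eq (by omega) hD]
    exact mul_ne_zero hpi (h.b_ne_zero hD₁)
  set s := 2 * Real.pi * Complex.I / EllipticOP.h τ (k + 1)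
  have hts : EllipticOP.h τ (k + 1) / (2 * Real.pi * Complex.I) * s = 1 :=
    div_mul_div_cancel₀ hpi |>.trans (div_self hh)
  -- By proportionality of rows, `f_{n+1}` is, up to the factor `s`, the determinant of the first
  -- rows of both solutions. The first row of the claim is then Cramer's rule.
  have hf₁ : (Y₁ z).det = s * (Y₁ z 0 0 * Y z 0 1 - Y₁ z 0 1 * Y z 0 0) := by
    rw [Matrix.det_fin_two, hs.1, hs.2]
    ring
  have hf := Matrix.det_fin_two (Y z)
  rw [EllipticOP.R, Matrix.smul_mul, eq_comm, one_div, inv_smul_eq_iff₀ hdet]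
  ext i j
  fin_cases i <;> fin_cases j <;>
    simp only [Fin.zero_eta, Fin.mk_one, Fin.isValue, Matrix.mul_apply, Fin.sum_univ_two,
      Matrix.of_apply, Matrix.cons_val_zero, Matrix.cons_val_one, Matrix.smul_apply,
      Matrix.cons_val', Matrix.cons_val_fin_one, smul_eq_mul, zero_mul, add_zero]
  · rw [hf₁, hf, ← hg]
    linear_combination (-(Y₁ z 0 0 * Y z 0 1 - Y₁ z 0 1 * Y z 0 0) * Y z 1 0) * hts
  · rw [hf₁, hf, ← hg]
    linear_combination (-(Y₁ z 0 0 * Y z 0 1 - Y₁ z 0 1 * Y z 0 0) * Y z 1 1) * hts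
  · rw [hs.1]
    ring
  · rw [hs.2]
    ring
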